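/- Let $3\le m<\infty$ and let $A_{ab}=\langle a,b\mid \underbrace{aba\cdots}_{m}=\underbrace{bab\cdots}_{m}\rangle$ be the dihedral Artin group with coefficient $m$. Let $\Delta=\underbrace{aba\cdots}_{m}\in A_{ab}$, and call atoms the elements of $A_{ab}$ represented by the alternating words $aba\cdots$ and $bab\cdots$ of length $k$, $0<k<m$. Let $Y$ be the simplicial complex with vertex set $V=A_{ab}/\langle\Delta\rangle$ in which finitely many distinct cosets span a simplex if and only if any two of them are of the form $g\langle\Delta\rangle$ and $gx\langle\Delta\rangle$ for some $g\in A_{ab}$ and some atom $x$; $A_{ab}$ acts on $Y$ by left translation. Let $T$ be the graph (in fact a tree, the Bestvina tree) whose vertices are the elements of $V$ and the maximal simplices of $Y$, with an edge between $v\in V$ and a maximal simplex $\sigma$ if and only if $v\in\sigma$. For $s\in\{a,b\}$ let $\gamma_s\subseteq T$ be the axis of $s$, i.e. the bi-infinite geodesic line through all the vertices $s^k\langle\Delta\rangle$, $k\in\mathbf Z$. Let $\widehat T$ be the cone-off of $T$ along the lines $h\gamma_s$ ($h\in A_{ab}$, $s\in\{a,b\}$): the graph obtained from $T$ by adding one new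 vertex for each line of this form (one only if two of them coincide), joined by an edge to every vertex of $T$ on that line. The group $A_{ab}$ acts on $\widehat T$ by graph automorphisms; $\widehat T$ carries the graph distance. An element $g$ acts elliptically if the orbits of $\langle g\rangle$ are bounded, and loxodromically if the orbit maps $\mathbf Z\to\widehat T$, $n\mapsto g^n x$, are quasi-isometric embeddings. Then the elements of $A_{ab}$ acting elliptically on $\widehat T$ are precisely the elements $g\in A_{ab}$ that satisfy at least one of the following: (1) $g=h\,s^N h^{-1}\,W$ for some $h\in A_{ab}$, $s\in\{a,b\}$, $N\in\mathbf Z$ and $W\in Z(A_{ab})$; (2) there exists an integer $N\neq 0$ such that $g^N\in Z(A_{ab})$. All the other elements of $A_{ab}$ act loxodromically on $\widehat T$. -/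

import Mathlib

open scoped Pointwise

namespace DihedralArtin

/-- The two standard generators. -/
inductive Gen
  | a
  | b

/-- The alternating product `x y x y ⋯` with `k` factors, starting with `x`. -/
def alt {M : Type*} [Monoid M] (x y : M) : ℕ → M
  | 0 => 1
  | k + 1 => x * alt y x k

/-- The defining relator `(a b a ⋯) (b a b ⋯)⁻¹`, with `m` factors on each side. -/
def rels (m : ℕ) : Set (FreeGroup Gen) :=
  {alt (FreeGroup.of Gen.a) (FreeGroup.of Gen.b) m *
    (alt (FreeGroup.of Gen.b) (FreeGroup.of Gen.a) m)⁻¹}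

/-- The dihedral Artin group `⟨a, b | a b a ⋯ = b a b ⋯⟩` with coefficient `m`. -/
abbrev Artin (m : ℕ) : Type := PresentedGroup (rels m)

/-- A standard generator as an element of the group. -/
def gen (m : ℕ) (s : Gen) : Artin m := PresentedGroup.of s

/-- The Garside element `Δ = a b a ⋯` (`m` factors). -/
def garside (m : ℕ) : Artin m := alt (gen m Gen.a) (gen m Gen.b) m

/-- Atoms: the elements represented by the nonempty strict subwords of `a b a ⋯` or of `b a b ⋯`
(`m` letters each), that is, by the alternating words of length `0 < k < m`. -/
def IsAtom (m : ℕ) (x : Artin m) : Prop :=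
  ∃ k : ℕ, 0 < k ∧ k < m ∧
    (x = alt (gen m Gen.a) (gen m Gen.b) k ∨ x = alt (gen m Gen.b) (gen m Gen.a) k)

/-- The vertices `g⟨Δ⟩` of the complex `Y`; the group acts by left translation. -/
abbrev V (m : ℕ) : Type := Artin m ⧸ Subgroup.zpowers (garside m)

/-- The 1-skeleton of `Y`: distinct cosets `g⟨Δ⟩` and `g x⟨Δ⟩`, with `x` an atom, are adjacent. -/
def Y (m : ℕ) : SimpleGraph (V m) where
  Adj p q := p ≠ q ∧ ∃ g x : Artin m, IsAtom m x ∧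
    ((p = (g : V m) ∧ q = ((g * x : Artin m) : V m)) ∨
      (q = (g : V m) ∧ p = ((g * x : Artin m) : V m)))
  symm := ⟨fun _ _ h => ⟨h.1.symm, h.2.imp fun _ h => h.imp fun _ h => ⟨h.1, h.2.symm⟩⟩⟩
  loopless := ⟨fun _ h => h.1 rfl⟩

theorem Y_adj_smul {m : ℕ} (h : Artin m) {p q : V m} (hpq : (Y m).Adj p q) :
    (Y m).Adj (h • p) (h • q) := by
  obtain ⟨hne, g, x, hx, hgx⟩ := hpq
  refine ⟨fun e => hne (MulAction.injective h e), h * g, x, hx, ?_⟩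
  rcases hgx with ⟨rfl, rfl⟩ | ⟨rfl, rfl⟩
  · exact Or.inl ⟨rfl, by rw [mul_assoc]; rfl⟩
  · exact Or.inr ⟨rfl, by rw [mul_assoc]; rfl⟩

/-- The simplices of `Y`: finite nonempty sets of pairwise adjacent vertices. -/
def IsSimplex (m : ℕ) (σ : Set (V m)) : Prop :=
  σ.Finite ∧ σ.Nonempty ∧ (Y m).IsClique σ

theorem IsSimplex.smul {m : ℕ} (h : Artin m) {σ : Set (V m)} (hσ : IsSimplex m σ) :
    IsSimplex m (h • σ) := by
  obtain ⟨h1, h2, h3⟩ := hσ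
  refine ⟨h1.image _, h2.image _, ?_⟩
  rintro _ ⟨p, hp, rfl⟩ _ ⟨q, hq, rfl⟩ hne
  exact Y_adj_smul h (h3 hp hq fun e => hne (by rw [e]))

theorem maximal_simplex_smul {m : ℕ} (h : Artin m) {σ : Set (V m)}
    (hσ : Maximal (IsSimplex m) σ) : Maximal (IsSimplex m) (h • σ) := by
  refine ⟨hσ.1.smul h, fun τ hτ hle => ?_⟩
  have h1 : σ ≤ h⁻¹ • τ := by
    have := Set.smul_set_mono (a := h⁻¹) hle
    rwa [inv_smul_smul] at this
  have h2 := Set.smul_set_mono (a := h) (hσ.2 (hτ.smul h⁻¹) h1)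
  rwa [smul_inv_smul] at h2

/-- The maximal simplices of `Y`. -/
def V' (m : ℕ) : Type := {σ : Set (V m) // Maximal (IsSimplex m) σ}

instance (m : ℕ) : MulAction (Artin m) (V' m) where
  smul h σ := ⟨h • σ.1, maximal_simplex_smul h σ.2⟩
  one_smul σ := Subtype.ext (one_smul _ σ.1)
  mul_smul h k σ := Subtype.ext (mul_smul h k σ.1)

/-- The vertices of `T`; the group acts on each of the two summands. -/
abbrev VertT (m : ℕ) : Type := V m ⊕ V' m

/-- The Bestvina tree: a vertex of `Y` is joined to the maximal simplices that contain it. -/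
def T (m : ℕ) : SimpleGraph (VertT m) where
  Adj
    | .inl p, .inr σ => p ∈ σ.1
    | .inr σ, .inl p => p ∈ σ.1
    | _, _ => False
  symm := ⟨by rintro (p | σ) (q | τ) h <;> exact h⟩
  loopless := ⟨by rintro (p | σ) h <;> exact h⟩

/-- The axis `γ_s` of the standard generator `s` in `T` (its set of vertices): the union of the
geodesics of `T` that join vertices of the form `s ^ k ⟨Δ⟩`, `k ∈ ℤ`. -/
def axis (m : ℕ) (s : Gen) : Set (VertT m) :=
  {v | ∃ (k l : ℤ) (p : (T m).Walk (.inl ((gen m s ^ k : Artin m) : V m))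
      (.inl ((gen m s ^ l : Artin m) : V m))),
    p.length = (T m).dist (.inl ((gen m s ^ k : Artin m) : V m))
      (.inl ((gen m s ^ l : Artin m) : V m)) ∧ v ∈ p.support}

/-- The translates `h • γ_s` of the axes, as lines: each line is counted once. -/
def Axes (m : ℕ) : Type :=
  {L : Set (VertT m) // ∃ (h : Artin m) (s : Gen), L = h • axis m s}

instance (m : ℕ) : MulAction (Artin m) (Axes m) where
  smul h L := ⟨h • L.1, by
    obtain ⟨k, s, hL⟩ := L.2
    exact ⟨h * k, s, by rw [hL, mul_smul]⟩⟩
  one_smul L := Subtype.ext (one_smul _ L.1)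
  mul_smul h k L := Subtype.ext (mul_smul h k L.1)

/-- The vertices of the cone-off: those of `T` and one for each translate of an axis. -/
abbrev VertHatT (m : ℕ) : Type := VertT m ⊕ Axes m

/-- The cone-off of `T`: keep the edges of `T`, and join the vertex of each line
`h • γ_s` to all the vertices of `T` on that line. -/
def HatT (m : ℕ) : SimpleGraph (VertHatT m) where
  Adj
    | .inl v, .inl w => (T m).Adj v w
    | .inl v, .inr L => v ∈ L.1
    | .inr L, .inl v => v ∈ L.1
    | .inr _, .inr _ => False
  symm := ⟨by
    rintro (v | L) (w | M) h
    · exact SimpleGraph.Adj.symm h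
    · exact h
    · exact h
    · exact h⟩
  loopless := ⟨by
    rintro (v | L) h
    · exact (T m).irrefl h
    · exact h⟩

/-- The group acts on `T` by graph automorphisms. -/
theorem T_adj_smul {m : ℕ} (h : Artin m) (v w : VertT m) :
    (T m).Adj (h • v) (h • w) ↔ (T m).Adj v w := by
  rcases v with p | σ <;> rcases w with q | τ
  · exact Iff.rfl
  · exact Set.smul_mem_smul_set_iff
  · exact Set.smul_mem_smul_set_iff
  · exact Iff.rfl

/-- The group acts on the cone-off by graph automorphisms. -/
theorem HatT_adj_smul {m : ℕ} (h : Artin m) (v w : VertHatT m) :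
    (HatT m).Adj (h • v) (h • w) ↔ (HatT m).Adj v w := by
  rcases v with p | σ <;> rcases w with q | τ
  · exact T_adj_smul h p q
  · exact Set.smul_mem_smul_set_iff
  · exact Set.smul_mem_smul_set_iff
  · exact Iff.rfl

end DihedralArtin

/-- An element `g` of a group acting on a graph acts elliptically if the orbits of `⟨g⟩` on the
vertices are bounded for the graph distance (which is `⊤` between different components). -/
def ActsElliptically {A X : Type*} [Group A] [MulAction A X] (G : SimpleGraph X) (g : A) : Prop :=
  ∀ x : X, ∃ D : ℕ, ∀ i j : ℤ, G.edist (g ^ i • x) (g ^ j • x) ≤ (D : ℕ∞)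

/-- An element `g` of a group acting on a graph acts loxodromically if its orbit maps
`ℤ → X`, `n ↦ g ^ n • x`, are quasi-isometric embeddings for the graph distance. -/
def ActsLoxodromically {A X : Type*} [Group A] [MulAction A X] (G : SimpleGraph X) (g : A) :
    Prop :=
  ∀ x : X, ∃ K C : ℕ, ∀ i j : ℤ,
    G.edist (g ^ i • x) (g ^ j • x) ≤ (K : ℕ∞) * ((i - j).natAbs : ℕ∞) + (C : ℕ∞) ∧
    ((i - j).natAbs : ℕ∞) ≤ (K : ℕ∞) * G.edist (g ^ i • x) (g ^ j • x) + (C : ℕ∞)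

/-!
The idea is to give explicit reduced words for the Bestvina tree and to detect loxodromic elements
by a function on the tree that is coarsely Lipschitz for the metric of the cone-off.

**Words.** The Artin group `A` has index two in its extension `Ext m` by the involution `τ` that
exchanges `a` and `b`. With `u = a τ` one has `a = u τ`, `b = τ u`, the element `z = u ^ m` is
central, and `Δ = z τ ^ m`. Modulo `⟨z⟩` the extension is the free product of the cyclic groups
generated by `u` and `τ`, of orders `m` and two. The vertices of `Y` are the cosets `h⟨τ, z⟩`, the
neighbours of `h⟨τ, z⟩` are the cosets of `h u ^ t` and `h τ u ^ t`, and maximal simplices are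
cosets of `⟨u, z⟩`. A path in the tree thus has a sequence of turns in `ZMod m \ {0}`, the exponents
of `u` in a reduced word. The reduced words are obtained from a right action of `Ext m` on pairs
(`RedWord`), so no normal form theorem for free products is needed: only the words of elements are
used, and never that the words determine the elements.

**Axes.** The function `lenV`, the number of turns from the base vertex, changes by at most one
along edges of `Y`, and a vertex has only one neighbour of smaller length (`eq_of_adj_of_lenV_lt`).
So the geodesics between the vertices `s ^ k ⟨Δ⟩` pass only through vertices of this form
(`exists_eq_gen_zpow_of_mem_axis`). In terms of turns, the translates of the two axes are the lines
that have all turns equal to `1` in one direction, and to `-1` in the other.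

**Breaks.** A break of a path is a pair of consecutive turns that are not both `1` and not both
`-1`. The paths from the base vertex to two points of one line differ only along the line, where
there are no breaks, and near the places where they enter it, so the number of breaks `brkV`
varies by a bounded amount on each line. Hence it is coarsely Lipschitz on the cone-off (`brkV_le_dist`).

**Classification.** Up to powers of `z`, each element is conjugate in `Ext m` to a power of `u`, to
`τ`, or to a cyclically reduced word `u ^ t₁ τ ⋯ u ^ tₙ τ` (`hasCycRed`). In the first two cases a
power of the element is in `⟨z⟩`. If all `tᵢ` are `1`, or all are `-1`, it is conjugate in `A` to a
power of a generator up to a central factor, and elliptic since the axis of a generator is coned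
off. Otherwise the number of breaks of its `n`-th power is at least `n - 1`
(`le_brk_prodW_pow`), so that it is loxodromic. Finally, a central element commutes with `u ^ 2`,
which excludes the third form (`pow_eq_of_mem_center`), so it has a power in `⟨z⟩`, and such powers
act trivially.
-/

open scoped Pointwise

namespace DihedralArtin

/-! ### The extension of the Artin group by the swap of the generators -/

theorem map_alt {M N : Type*} [Monoid M] [Monoid N] (f : M →* N) (x y : M) (k : ℕ) :
    f (alt x y k) = alt (f x) (f y) k := by
  induction k generalizing x y with
  | zero => simp [alt]
  | succ k ih => simp [alt, ih]

/-- If `τ` is an involution, alternating words in `u * τ` and `τ * u` are powers of `u`,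
up to factors `τ`. -/
theorem alt_involution {G : Type*} [Group G] (u τ : G) (hτ : τ * τ = 1) (k : ℕ) :
    alt (u * τ) (τ * u) k * τ ^ k = u ^ k ∧ alt (τ * u) (u * τ) k * τ ^ k = τ * u ^ k * τ := by
  induction k with
  | zero => simp [alt, hτ]
  | succ k ih =>
    constructor
    · calc alt (u * τ) (τ * u) (k + 1) * τ ^ (k + 1)
          = u * τ * (alt (τ * u) (u * τ) k * τ ^ k) * τ := by simp only [alt, pow_succ, mul_assoc]
        _ = u * (τ * τ) * u ^ k * (τ * τ) := by rw [ih.2]; simp only [mul_assoc]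
        _ = u ^ (k + 1) := by rw [hτ, pow_succ']; simp
    · calc alt (τ * u) (u * τ) (k + 1) * τ ^ (k + 1)
          = τ * u * (alt (u * τ) (τ * u) k * τ ^ k) * τ := by simp only [alt, pow_succ, mul_assoc]
        _ = τ * u ^ (k + 1) * τ := by rw [ih.1, pow_succ']; simp only [mul_assoc]

theorem garside_eq (m : ℕ) :
    alt (gen m Gen.a) (gen m Gen.b) m = alt (gen m Gen.b) (gen m Gen.a) m := by
  have h : PresentedGroup.mk (rels m) (alt (FreeGroup.of Gen.a) (FreeGroup.of Gen.b) m *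
    (alt (FreeGroup.of Gen.b) (FreeGroup.of Gen.a) m)⁻¹) = 1 :=
    PresentedGroup.one_of_mem rfl
  rw [map_mul, map_inv, mul_inv_eq_one, map_alt, map_alt] at h
  exact h

/-- The homomorphism out of the Artin group defined by two elements that satisfy its relation. -/
def liftGen {m : ℕ} {G : Type*} [Group G] (x y : G) (h : alt x y m = alt y x m) : Artin m →* G :=
  PresentedGroup.toGroup (f := fun s => Gen.casesOn s x y) (by
    rintro _ rfl
    rw [map_mul, map_inv, mul_inv_eq_one, map_alt, map_alt]
    simpa using h)

@[simp] theorem liftGen_a {m : ℕ} {G : Type*} [Group G] (x y : G) (h : alt x y m = alt y x m) :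
    liftGen x y h (gen m Gen.a) = x := PresentedGroup.toGroup.of _

@[simp] theorem liftGen_b {m : ℕ} {G : Type*} [Group G] (x y : G) (h : alt x y m = alt y x m) :
    liftGen x y h (gen m Gen.b) = y := PresentedGroup.toGroup.of _

theorem closure_gen {m : ℕ} : Subgroup.closure {gen m Gen.a, gen m Gen.b} = ⊤ := by
  rw [eq_top_iff, ← PresentedGroup.closure_range_of (rels m)]
  refine Subgroup.closure_mono ?_
  rintro _ ⟨s, rfl⟩
  cases s
  · exact Or.inl rfl
  · exact Or.inr rfl

theorem hom_ext {m : ℕ} {G : Type*} [Monoid G] {f g : Artin m →* G}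
    (ha : f (gen m Gen.a) = g (gen m Gen.a)) (hb : f (gen m Gen.b) = g (gen m Gen.b)) : f = g := by
  refine MonoidHom.eq_of_eqOn_dense closure_gen ?_
  rintro _ (rfl | rfl)
  · exact ha
  · exact hb

/-- The endomorphism that exchanges the two generators. -/
def swapHom (m : ℕ) : Artin m →* Artin m :=
  liftGen (gen m Gen.b) (gen m Gen.a) (garside_eq m).symm

theorem swapHom_comp (m : ℕ) : (swapHom m).comp (swapHom m) = MonoidHom.id _ :=
  hom_ext (by simp [swapHom]) (by simp [swapHom])

/-- The automorphism that exchanges the two generators. -/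
def swap (m : ℕ) : MulAut (Artin m) :=
  MonoidHom.toMulEquiv (swapHom m) (swapHom m) (swapHom_comp m) (swapHom_comp m)

theorem swap_mul_swap (m : ℕ) : swap m * swap m = 1 :=
  MulEquiv.ext fun x => DFunLike.congr_fun (swapHom_comp m) x

@[simp] theorem swap_a (m : ℕ) : swap m (gen m Gen.a) = gen m Gen.b :=
  liftGen_a _ _ (garside_eq m).symm

@[simp] theorem swap_b (m : ℕ) : swap m (gen m Gen.b) = gen m Gen.a :=
  liftGen_b _ _ (garside_eq m).symm

@[simp] theorem swap_garside (m : ℕ) : swap m (garside m) = garside m := by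
  have := map_alt (swap m).toMonoidHom (gen m Gen.a) (gen m Gen.b) m
  simp only [MulEquiv.toMonoidHom_eq_coe, MonoidHom.coe_coe, swap_a, swap_b] at this
  rw [garside, this, garside_eq]

/-- The homomorphism from the group `{1, -1}` defined by an involution. -/
def involutionHom {G : Type*} [Group G] (g : G) (hg : g * g = 1) : ℤˣ →* G where
  toFun ε := if ε = 1 then 1 else g
  map_one' := if_pos rfl
  map_mul' ε δ := by
    rcases Int.units_eq_one_or ε with rfl | rfl <;> rcases Int.units_eq_one_or δ with rfl | rfl <;>
      simp [hg]

theorem involutionHom_neg_one {G : Type*} [Group G] (g : G) (hg : g * g = 1) :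
    involutionHom g hg (-1) = g := by
  have h : (-1 : ℤˣ) ≠ 1 := by decide
  simp [involutionHom, h]

/-- The extension of the Artin group by the automorphism of order two that exchanges the
generators. -/
abbrev Ext (m : ℕ) : Type :=
  Artin m ⋊[involutionHom (swap m) (swap_mul_swap m)] ℤˣ

/-- The inclusion of the Artin group in its extension. -/
abbrev inA {m : ℕ} : Artin m →* Ext m := SemidirectProduct.inl

/-- The involution of the extension that conjugates `a` to `b`. -/
def tau (m : ℕ) : Ext m := SemidirectProduct.inr (-1)

/-- The element `u = a τ`; the extension is generated by `u` and `τ`. -/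
def uu (m : ℕ) : Ext m := inA (gen m Gen.a) * tau m

/-- The central element `u ^ m`. -/
def zz (m : ℕ) : Ext m := uu m ^ m

variable {m : ℕ}

@[simp] theorem tau_mul_tau : tau m * tau m = 1 := by
  rw [tau, ← map_mul]; simp

@[simp] theorem tau_mul_tau_mul (h : Ext m) : tau m * (tau m * h) = h := by
  rw [← mul_assoc, tau_mul_tau, one_mul]

@[simp] theorem tau_inv : (tau m)⁻¹ = tau m := inv_eq_of_mul_eq_one_left tau_mul_tau

theorem tau_conj (g : Artin m) : tau m * inA g * tau m = inA (swap m g) := by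
  have := SemidirectProduct.inl_aut (φ := involutionHom (swap m) (swap_mul_swap m)) (-1) g
  rw [involutionHom_neg_one] at this
  rw [inA, this, map_inv, ← tau, tau_inv]

theorem inA_a : inA (gen m Gen.a) = uu m * tau m := by simp [uu, mul_assoc]

theorem inA_b : inA (gen m Gen.b) = tau m * uu m := by
  rw [← swap_a, ← tau_conj, uu, mul_assoc]

theorem inA_alt_a (k : ℕ) :
    inA (alt (gen m Gen.a) (gen m Gen.b) k) * tau m ^ k = uu m ^ k := by
  rw [map_alt, inA_a, inA_b]
  exact (alt_involution _ _ tau_mul_tau k).1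

theorem inA_alt_b (k : ℕ) :
    inA (alt (gen m Gen.b) (gen m Gen.a) k) * tau m ^ k = tau m * uu m ^ k * tau m := by
  rw [map_alt, inA_a, inA_b]
  exact (alt_involution _ _ tau_mul_tau k).2

theorem zz_eq : zz m = inA (garside m) * tau m ^ m := (inA_alt_a m).symm

theorem zz_zpow_eq (i : ℤ) : ∃ ε : ℤˣ,
    zz m ^ i = inA (garside m ^ i) * SemidirectProduct.inr ε := by
  have hc : Commute (inA (garside m)) (tau m) := by
    have := tau_conj (garside m)
    rw [swap_garside] at this
    calc inA (garside m) * tau m = tau m * inA (garside m) * tau m * tau m := by rw [this]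
      _ = tau m * inA (garside m) := by simp [mul_assoc]
  refine ⟨((-1) ^ m) ^ i, ?_⟩
  rw [zz_eq, (hc.pow_right m).mul_zpow, map_zpow, map_zpow, map_pow]
  rfl

theorem closure_uu_tau : Subgroup.closure {uu m, tau m} = ⊤ := by
  rw [eq_top_iff]
  have hu : uu m ∈ Subgroup.closure {uu m, tau m} := Subgroup.subset_closure (by simp)
  have ht : tau m ∈ Subgroup.closure {uu m, tau m} := Subgroup.subset_closure (by simp)
  have hA : ∀ g : Artin m, inA g ∈ Subgroup.closure {uu m, tau m} := by
    intro g
    have : Subgroup.closure {gen m Gen.a, gen m Gen.b} ≤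
        (Subgroup.closure {uu m, tau m}).comap inA := by
      rw [Subgroup.closure_le]
      rintro _ (rfl | rfl)
      · simp only [SetLike.mem_coe, Subgroup.mem_comap]
        rw [inA_a]; exact mul_mem hu ht
      · simp only [SetLike.mem_coe, Subgroup.mem_comap]
        rw [inA_b]; exact mul_mem ht hu
    rw [closure_gen] at this
    exact this (Subgroup.mem_top g)
  intro h _
  rw [← SemidirectProduct.inl_left_mul_inr_right h]
  refine mul_mem (hA _) ?_
  rcases Int.units_eq_one_or h.right with e | e <;> rw [e]
  · rw [map_one]; exact one_mem _
  · exact ht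

theorem zz_comm (h : Ext m) : zz m * h = h * zz m := by
  have ht : zz m * tau m = tau m * zz m := by
    have h1 := inA_alt_b (m := m) m
    rw [← garside_eq, inA_alt_a, mul_assoc] at h1
    calc zz m * tau m = tau m * (uu m ^ m * tau m) * tau m := by rw [← h1]; rfl
      _ = tau m * zz m := by simp [mul_assoc, zz]
  have hz : zz m ∈ Subgroup.centralizer {uu m, tau m} := by
    rw [Subgroup.mem_centralizer_iff]
    rintro _ (rfl | rfl)
    · exact (pow_succ' _ _).symm.trans (pow_succ _ _)
    · exact ht.symm
  rw [← Subgroup.centralizer_closure, closure_uu_tau, Subgroup.mem_centralizer_iff] at hz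
  exact (hz h (Subgroup.mem_top h)).symm

theorem zz_zpow_comm (k : ℤ) (h : Ext m) : zz m ^ k * h = h * zz m ^ k :=
  Commute.zpow_left (zz_comm h) k

/-- Every element of the extension is in the Artin group up to a factor `τ` on the right. -/
theorem exists_inA (h : Ext m) : ∃ g : Artin m, h = inA g ∨ h = inA g * tau m := by
  refine ⟨h.left, ?_⟩
  rcases Int.units_eq_one_or h.right with e | e
  · left
    conv_lhs => rw [← SemidirectProduct.inl_left_mul_inr_right h, e, map_one, mul_one]
  · right
    conv_lhs => rw [← SemidirectProduct.inl_left_mul_inr_right h, e]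
    rfl

/-! ### Vertices as cosets in the extension -/

/-- The vertex of `Y` given by an element of the extension, whose cosets modulo `⟨τ, z⟩` are
the vertices of `Y`. -/
def vert (h : Ext m) : V m := (h.left : V m)

@[simp] theorem vert_inA (g : Artin m) : vert (inA g) = (g : V m) := rfl

theorem vert_inA_mul (g : Artin m) (h : Ext m) : vert (inA g * h) = g • vert h := by
  simp [vert]

@[simp] theorem vert_mul_tau (h : Ext m) : vert (h * tau m) = vert h := by
  simp [vert, tau]

@[simp] theorem vert_mul_tau_pow (h : Ext m) (k : ℕ) : vert (h * tau m ^ k) = vert h := by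
  induction k with
  | zero => simp
  | succ k ih => rw [pow_succ, ← mul_assoc, vert_mul_tau, ih]

theorem swap_zpow_garside (ε : ℤˣ) :
    involutionHom (swap m) (swap_mul_swap m) ε (garside m) = garside m := by
  rcases Int.units_eq_one_or ε with rfl | rfl
  · simp
  · rw [involutionHom_neg_one, swap_garside]

@[simp] theorem vert_mul_zz (h : Ext m) : vert (h * zz m) = vert h := by
  rw [zz_eq, ← mul_assoc, vert_mul_tau_pow]
  simp only [vert, SemidirectProduct.mul_left, SemidirectProduct.left_inl, swap_zpow_garside]
  exact QuotientGroup.mk_mul_of_mem _ (Subgroup.mem_zpowers _)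

@[simp] theorem vert_mul_zz_zpow (h : Ext m) (k : ℤ) : vert (h * zz m ^ k) = vert h := by
  induction k with
  | zero => simp
  | succ k ih => rw [zpow_add_one, ← mul_assoc, vert_mul_zz, ih]
  | pred k ih => rw [← ih, zpow_sub_one, ← vert_mul_zz (h * (_ * _))]; simp [mul_assoc]

theorem exists_of_vert_eq {h h' : Ext m} (e : vert h = vert h') :
    ∃ i : ℤ, h = h' * zz m ^ i ∨ h = h' * zz m ^ i * tau m := by
  rw [vert, vert, eq_comm, QuotientGroup.eq, Subgroup.mem_zpowers_iff] at e
  obtain ⟨i, hi⟩ := e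
  have hg : h.left = h'.left * garside m ^ i := by rw [hi]; simp
  have hl : (h' * zz m ^ i).left = h.left := by
    obtain ⟨ε, hε⟩ := zz_zpow_eq (m := m) i
    rw [hε, hg, SemidirectProduct.mul_left, SemidirectProduct.mul_left,
      SemidirectProduct.left_inl, SemidirectProduct.left_inr, map_one, mul_one, map_zpow,
      swap_zpow_garside]
  refine ⟨i, ?_⟩
  rcases eq_or_ne (h' * zz m ^ i).right h.right with hr | hr
  · exact Or.inl (SemidirectProduct.ext hl.symm hr.symm)
  · refine Or.inr (SemidirectProduct.ext ?_ ?_)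
    · simp [tau, hl]
    · have h2 : ∀ x y : ℤˣ, x ≠ y → y = x * -1 := by decide
      exact h2 _ _ hr


/-! ### Reduced words -/

/-- The sequences of turns of paths in the tree that cross vertices of degree `m`; the first entry
is the last turn. -/
abbrev Turns (m : ℕ) : Type := List {x : ZMod m // x ≠ 0}

/-- A reduced word `u ^ t₁ τ ⋯ u ^ tₙ τ u ^ c`, up to a factor `τ` on the left, as the pair of `c`
(which may be zero) and of the list of the nonzero exponents `tₙ, …, t₁`. -/
abbrev RedWord (m : ℕ) : Type := ZMod m × Turns m

/-- Right multiplication of a reduced word by `τ`. The empty word is fixed, since words are taken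
up to a factor `τ` on the left. -/
def flip : RedWord m → RedWord m
  | (c, L) => if h : c = 0 then
      match L with
      | [] => (0, [])
      | y :: L => (y.1, L)
    else (0, ⟨c, h⟩ :: L)

@[simp] theorem flip_nil : flip ((0, []) : RedWord m) = (0, []) := by simp [flip]

@[simp] theorem flip_cons (y : {x : ZMod m // x ≠ 0}) (L : Turns m) :
    flip (0, y :: L) = (y.1, L) := by simp [flip]

theorem flip_of_ne {c : ZMod m} (h : c ≠ 0) (L : Turns m) :
    flip (c, L) = (0, ⟨c, h⟩ :: L) := by simp [flip, h]

theorem flip_flip (s : RedWord m) : flip (flip s) = s := by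
  obtain ⟨c, L⟩ := s
  by_cases h : c = 0
  · subst h
    cases L with
    | nil => simp
    | cons y L => rw [flip_cons, flip_of_ne y.2]
  · rw [flip_of_ne h, flip_cons]

/-- Right multiplication of a reduced word by `τ`, as a permutation. -/
def flipPerm : Equiv.Perm (RedWord m) := ⟨flip, flip, flip_flip, flip_flip⟩

/-- Right multiplication of a reduced word by `u`, as a permutation. -/
def rotPerm : Equiv.Perm (RedWord m) := (Equiv.addRight 1).prodCongr (Equiv.refl _)

theorem rotPerm_pow (k : ℕ) (s : RedWord m) : (rotPerm ^ k) s = (s.1 + k, s.2) := by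
  induction k with
  | zero => simp
  | succ k ih =>
    rw [pow_succ', Equiv.Perm.mul_apply, ih]
    simp [rotPerm, add_assoc]

theorem rotPerm_pow_self : (rotPerm : Equiv.Perm (RedWord m)) ^ m = 1 :=
  Equiv.ext fun s => by simp [rotPerm_pow]

theorem flipPerm_mul_flipPerm : (flipPerm : Equiv.Perm (RedWord m)) * flipPerm = 1 :=
  Equiv.ext flip_flip

/-- The permutations of reduced words, with the composition of right actions. -/
abbrev RPerm (m : ℕ) : Type := (Equiv.Perm (RedWord m))ᵐᵒᵖ

theorem alt_rot_flip :
    let u : RPerm m := MulOpposite.op rotPerm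
    let τ : RPerm m := MulOpposite.op flipPerm
    alt (u * τ) (τ * u) m = alt (τ * u) (u * τ) m := by
  intro u τ
  have hτ : τ * τ = 1 := by
    rw [← MulOpposite.op_mul, flipPerm_mul_flipPerm]; rfl
  have hu : u ^ m = 1 := by
    rw [← MulOpposite.op_pow, rotPerm_pow_self]; rfl
  obtain ⟨h1, h2⟩ := alt_involution u τ hτ m
  rw [hu] at h1 h2
  rw [mul_one, hτ] at h2
  exact mul_right_cancel (h1.trans h2.symm)

/-- The right action of the extension on reduced words. -/
def act (m : ℕ) : Ext m →* RPerm m :=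
  SemidirectProduct.lift
    (liftGen (MulOpposite.op rotPerm * MulOpposite.op flipPerm)
      (MulOpposite.op flipPerm * MulOpposite.op rotPerm) alt_rot_flip)
    (involutionHom (MulOpposite.op flipPerm)
      (by rw [← MulOpposite.op_mul, flipPerm_mul_flipPerm]; rfl)) (by
    have hτ : (MulOpposite.op flipPerm : RPerm m) * MulOpposite.op flipPerm = 1 := by
      rw [← MulOpposite.op_mul, flipPerm_mul_flipPerm]; rfl
    intro ε
    rcases Int.units_eq_one_or ε with rfl | rfl
    · exact hom_ext (by simp) (by simp)
    · rw [involutionHom_neg_one, involutionHom_neg_one]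
      have hi := inv_eq_of_mul_eq_one_left hτ
      refine hom_ext ?_ ?_
      · simp [MulAut.conj_apply, hi, mul_assoc, hτ]
      · simp only [MonoidHom.comp_apply, MulEquiv.coe_toMonoidHom, swap_b, liftGen_a, liftGen_b,
          MulAut.conj_apply, hi]
        rw [← mul_assoc (MulOpposite.op flipPerm), hτ, one_mul])

theorem act_tau : act m (tau m) = MulOpposite.op flipPerm := by
  rw [act, tau, SemidirectProduct.lift_inr, involutionHom_neg_one]

theorem act_uu : act m (uu m) = MulOpposite.op rotPerm := by
  rw [uu, map_mul, act_tau, act, inA, SemidirectProduct.lift_inl, liftGen_a, mul_assoc,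
    ← MulOpposite.op_mul, flipPerm_mul_flipPerm]
  simp

/-- The reduced word of an element of the extension. -/
def word (h : Ext m) : RedWord m := (act m h).unop (0, [])

@[simp] theorem word_one : word (1 : Ext m) = (0, []) := by simp [word]

@[simp] theorem word_mul_tau (h : Ext m) : word (h * tau m) = flip (word h) := by
  simp [word, act_tau, flipPerm]

@[simp] theorem word_tau : word (tau m) = (0, []) := by
  rw [← one_mul (tau m), word_mul_tau, word_one, flip_nil]

theorem word_mul_uu_pow (h : Ext m) (k : ℕ) :
    word (h * uu m ^ k) = ((word h).1 + k, (word h).2) := by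
  rw [word, map_mul, map_pow, act_uu, ← MulOpposite.op_pow, MulOpposite.unop_mul,
    Equiv.Perm.mul_apply, MulOpposite.unop_op, rotPerm_pow]
  rfl

@[simp] theorem word_mul_uu_zpow (h : Ext m) (k : ℤ) :
    word (h * uu m ^ k) = ((word h).1 + k, (word h).2) := by
  obtain ⟨n, rfl | rfl⟩ := k.eq_nat_or_neg
  · rw [zpow_natCast, word_mul_uu_pow]; simp
  · have := word_mul_uu_pow (h * uu m ^ (-n : ℤ)) n
    rw [zpow_neg, zpow_natCast, inv_mul_cancel_right] at this
    rw [zpow_neg, zpow_natCast, this]; simp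

@[simp] theorem word_mul_uu (h : Ext m) : word (h * uu m) = ((word h).1 + 1, (word h).2) := by
  simpa using word_mul_uu_zpow h 1

@[simp] theorem word_mul_zz (h : Ext m) : word (h * zz m) = word h := by
  rw [zz, word_mul_uu_pow]; simp

@[simp] theorem word_mul_zz_zpow (h : Ext m) (k : ℤ) : word (h * zz m ^ k) = word h := by
  induction k with
  | zero => simp
  | succ k ih => rw [zpow_add_one, ← mul_assoc, word_mul_zz, ih]
  | pred k ih => rw [← ih, zpow_sub_one, ← word_mul_zz (h * (_ * _))]; simp [mul_assoc]

/-! ### Lengths and breaks -/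

/-- The turns of the path to the vertex `h⟨τ, z⟩` for a reduced word of `h`: a last exponent `c`
that is zero is no turn. -/
def turns : RedWord m → List (ZMod m)
  | (c, L) => if c = 0 then L.map Subtype.val else c :: L.map Subtype.val

theorem turns_zero (L : Turns m) : turns (0, L) = L.map Subtype.val := if_pos rfl

theorem turns_of_ne {c : ZMod m} (h : c ≠ 0) (L : Turns m) :
    turns (c, L) = c :: L.map Subtype.val := if_neg h

@[simp] theorem turns_flip (s : RedWord m) : turns (flip s) = turns s := by
  obtain ⟨c, L⟩ := s
  by_cases h : c = 0
  · subst h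
    cases L with
    | nil => simp
    | cons y L => rw [flip_cons, turns_of_ne y.2, turns_zero]; rfl
  · rw [flip_of_ne h, turns_zero, turns_of_ne h]; rfl

/-- The number of places in a list of turns where two consecutive turns are not both `1` and not
both `-1`. -/
def breaks : List (ZMod m) → ℕ
  | x :: y :: l => breaks (y :: l) + if x = y ∧ (x = 1 ∨ x = -1) then 0 else 1
  | _ => 0

@[simp] theorem breaks_nil : breaks ([] : List (ZMod m)) = 0 := rfl
@[simp] theorem breaks_singleton (x : ZMod m) : breaks [x] = 0 := rfl
theorem breaks_cons_cons (x y : ZMod m) (l : List (ZMod m)) : breaks (x :: y :: l) =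
    breaks (y :: l) + if x = y ∧ (x = 1 ∨ x = -1) then 0 else 1 := rfl

theorem breaks_cons_le (x : ZMod m) (l : List (ZMod m)) :
    breaks l ≤ breaks (x :: l) ∧ breaks (x :: l) ≤ breaks l + 1 := by
  cases l with
  | nil => simp
  | cons y l => rw [breaks_cons_cons]; split_ifs <;> omega

theorem breaks_append (l : List (ZMod m)) (x : ZMod m) (l' : List (ZMod m)) :
    breaks (l ++ x :: l') = breaks (l ++ [x]) + breaks (x :: l') := by
  induction l with
  | nil => simp
  | cons y l ih =>
    cases l with
    | nil => simp [breaks_cons_cons]; omega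
    | cons y' l =>
      simp only [List.cons_append, breaks_cons_cons] at ih ⊢
      omega

theorem eq_of_breaks_eq_zero (x : ZMod m) (l : List (ZMod m)) (hl : l ≠ [])
    (h : breaks (l ++ [x]) = 0) : (x = 1 ∨ x = -1) ∧ ∀ y ∈ l, y = x := by
  induction l with
  | nil => exact absurd rfl hl
  | cons y l ih =>
    cases l with
    | nil =>
      simp only [List.cons_append, List.nil_append, breaks_cons_cons, breaks_singleton] at h
      split_ifs at h with h1
      · obtain ⟨rfl, h1⟩ := h1
        exact ⟨h1, by simp⟩
    | cons y' l =>
      simp only [List.cons_append, breaks_cons_cons] at h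
      split_ifs at h with h1
      · obtain ⟨h2, h3⟩ := ih (by simp) h
        refine ⟨h2, ?_⟩
        intro w hw
        rcases List.mem_cons.1 hw with rfl | hw
        · rw [h1.1]; exact h3 _ (by simp)
        · exact h3 w hw

/-- The number of breaks in the path to the vertex defined by a reduced word. -/
def brk (s : RedWord m) : ℕ := breaks (turns s)

/-- The number of turns of the path to the vertex defined by a reduced word. -/
def len (s : RedWord m) : ℕ := (turns s).length

@[simp] theorem brk_flip (s : RedWord m) : brk (flip s) = brk s := by simp [brk]
@[simp] theorem len_flip (s : RedWord m) : len (flip s) = len s := by simp [len]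

theorem breaks_le_brk (c : ZMod m) (L : Turns m) :
    breaks (L.map Subtype.val) ≤ brk (c, L) ∧ brk (c, L) ≤ breaks (L.map Subtype.val) + 1 := by
  by_cases h : c = 0
  · subst h; rw [brk, turns_zero]; omega
  · rw [brk, turns_of_ne h]; exact breaks_cons_le _ _

theorem length_le_len (c : ZMod m) (L : Turns m) :
    L.length ≤ len (c, L) ∧ len (c, L) ≤ L.length + 1 := by
  by_cases h : c = 0
  · subst h; rw [len, turns_zero]; simp
  · rw [len, turns_of_ne h]; simp

/-- The effect of right multiplication by `a = u τ` on reduced words. -/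
def stepA (s : RedWord m) : RedWord m := flip (s.1 + 1, s.2)

theorem word_mul_a_pow (h : Ext m) (k : ℕ) :
    word (h * (uu m * tau m) ^ k) = stepA^[k] (word h) := by
  induction k with
  | zero => simp
  | succ k ih =>
    rw [pow_succ, ← mul_assoc, ← mul_assoc, word_mul_tau, word_mul_uu, ih,
      Function.iterate_succ_apply', stepA]

theorem one_ne_zero' (hm : 3 ≤ m) : (1 : ZMod m) ≠ 0 := by
  have : Fact (1 < m) := ⟨by omega⟩
  exact one_ne_zero

theorem brk_iterate_one (h1 : (1 : ZMod m) ≠ 0) (k : ℕ) (L : Turns m) :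
    brk (stepA^[k] (0, ⟨1, h1⟩ :: L)) = brk (0, ⟨1, h1⟩ :: L) := by
  induction k generalizing L with
  | zero => rfl
  | succ k ih =>
    rw [Function.iterate_succ_apply, stepA]
    simp only [zero_add]
    rw [flip_of_ne h1, ih]
    simp [brk, turns_zero, breaks_cons_cons]

theorem brk_iterate_zero (h1 : (1 : ZMod m) ≠ 0) (k : ℕ) (L : Turns m) :
    brk (0, L) ≤ brk (stepA^[k] (0, L)) ∧ brk (stepA^[k] (0, L)) ≤ brk (0, L) + 1 := by
  cases k with
  | zero => simp
  | succ k =>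
    rw [Function.iterate_succ_apply, stepA]
    simp only [zero_add]
    rw [flip_of_ne h1, brk_iterate_one, brk, brk, turns_zero, turns_zero]
    exact breaks_cons_le _ _

theorem brk_iterate_of_ne (h1 : (1 : ZMod m) ≠ 0) (k : ℕ) (c : ZMod m) (hc : c ≠ -1)
    (L : Turns m) : brk (c, L) ≤ brk (stepA^[k] (c, L)) + 1 ∧
      brk (stepA^[k] (c, L)) ≤ brk (c, L) + 2 := by
  cases k with
  | zero => simp
  | succ k =>
    have hc' : c + 1 ≠ 0 := fun h => hc (eq_neg_of_add_eq_zero_left h)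
    rw [Function.iterate_succ_apply, stepA]
    simp only
    rw [flip_of_ne hc']
    have h2 := brk_iterate_zero h1 k (⟨c + 1, hc'⟩ :: L)
    have h3 := breaks_le_brk c L
    have h4 := breaks_cons_le (c + 1) (L.map Subtype.val)
    have h5 : brk (0, (⟨c + 1, hc'⟩ :: L : Turns m)) = breaks ((c + 1) :: L.map Subtype.val) := by
      rw [brk, turns_zero]; rfl
    omega

/-- Moving along a translate of the axis of `a` changes the number of breaks by at most three:
cancelling turns `-1` and adding turns `1` creates no breaks, apart from the place where the
path leaves the line. -/
theorem brk_iterate_stepA (h1 : (1 : ZMod m) ≠ 0) (k : ℕ) (c : ZMod m) (L : Turns m) :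
    brk (c, L) ≤ brk (stepA^[k] (c, L)) + 3 ∧ brk (stepA^[k] (c, L)) ≤ brk (c, L) + 3 := by
  by_cases hc : c = -1
  swap
  · have := brk_iterate_of_ne h1 k c hc L; omega
  subst hc
  have hn : (-1 : ZMod m) ≠ 0 := neg_ne_zero.2 h1
  induction L generalizing k with
  | nil =>
    cases k with
    | zero => simp
    | succ k =>
      rw [Function.iterate_succ_apply, stepA]
      simp only [neg_add_cancel, flip_nil]
      have := brk_iterate_zero h1 k []
      have h2 : brk ((-1 : ZMod m), ([] : Turns m)) = 0 := by simp [brk, turns_of_ne hn]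
      have h3 : brk ((0 : ZMod m), ([] : Turns m)) = 0 := by simp [brk, turns_zero]
      omega
  | cons y L ih =>
    cases k with
    | zero => simp
    | succ k =>
      rw [Function.iterate_succ_apply, stepA]
      simp only [neg_add_cancel, flip_cons]
      obtain ⟨y, hy0⟩ := y
      dsimp only
      have e : brk ((-1 : ZMod m), ⟨y, hy0⟩ :: L) = brk (y, L) +
          if -1 = y ∧ ((-1 : ZMod m) = 1 ∨ (-1 : ZMod m) = -1) then 0 else 1 := by
        rw [brk, brk, turns_of_ne hn, turns_of_ne hy0]; rfl
      by_cases hy : y = -1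
      · subst hy
        rw [e]
        simpa using ih k
      · have := brk_iterate_of_ne h1 k y hy L
        rw [e]
        split_ifs <;> omega

theorem brk_mul_a_zpow (hm : 3 ≤ m) (h : Ext m) (k : ℤ) :
    brk (word h) ≤ brk (word (h * (uu m * tau m) ^ k)) + 3 ∧
      brk (word (h * (uu m * tau m) ^ k)) ≤ brk (word h) + 3 := by
  obtain ⟨n, rfl | rfl⟩ := k.eq_nat_or_neg
  · rw [zpow_natCast, word_mul_a_pow]
    exact brk_iterate_stepA (one_ne_zero' hm) n _ _
  · have := brk_iterate_stepA (one_ne_zero' hm) n (word (h * (uu m * tau m) ^ (-n : ℤ))).1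
      (word (h * (uu m * tau m) ^ (-n : ℤ))).2
    rw [Prod.mk.eta, ← word_mul_a_pow, zpow_neg, zpow_natCast, inv_mul_cancel_right] at this
    rw [zpow_neg, zpow_natCast]
    exact this.symm

theorem brk_mul_b_zpow (hm : 3 ≤ m) (h : Ext m) (k : ℤ) :
    brk (word h) ≤ brk (word (h * (tau m * uu m) ^ k)) + 3 ∧
      brk (word (h * (tau m * uu m) ^ k)) ≤ brk (word h) + 3 := by
  have e : (tau m * uu m) ^ k = tau m * (uu m * tau m) ^ k * tau m := by
    have := conj_zpow (i := k) (a := tau m) (b := uu m * tau m)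
    simpa [mul_assoc] using this
  rw [e, ← mul_assoc, ← mul_assoc, word_mul_tau, brk_flip]
  have := brk_mul_a_zpow hm (h * tau m) k
  rwa [word_mul_tau, brk_flip] at this


/-! ### Functions on the vertices of `Y` -/

/-- The number of breaks in the path from the base vertex to a vertex of `Y`. -/
noncomputable def brkV (p : V m) : ℕ := brk (word (inA p.out))

/-- The number of turns in the path from the base vertex to a vertex of `Y`. -/
noncomputable def lenV (p : V m) : ℕ := len (word (inA p.out))

theorem exists_vert_eq (p : V m) : ∃ g : Artin m, vert (inA g) = p := by
  obtain ⟨g, rfl⟩ := QuotientGroup.mk_surjective p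
  exact ⟨g, rfl⟩

theorem vert_inA_out (p : V m) : vert (inA p.out) = p := by
  rw [vert_inA]; exact Quotient.out_eq' p

@[simp] theorem brkV_vert (h : Ext m) : brkV (vert h) = brk (word h) := by
  obtain ⟨i, e | e⟩ := exists_of_vert_eq (vert_inA_out (vert h)) <;> rw [brkV, e] <;> simp

@[simp] theorem lenV_vert (h : Ext m) : lenV (vert h) = len (word h) := by
  obtain ⟨i, e | e⟩ := exists_of_vert_eq (vert_inA_out (vert h)) <;> rw [lenV, e] <;> simp

theorem exists_of_adj {p q : V m} (hpq : (Y m).Adj p q) :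
    ∃ (h : Ext m) (t : ℤ), p = vert h ∧ q = vert (h * uu m ^ t) := by
  obtain ⟨-, g, x, ⟨k, -, -, hx⟩, hgx⟩ := hpq
  have key : ∃ h : Ext m, (g : V m) = vert h ∧ ((g * x : Artin m) : V m) =
      vert (h * uu m ^ k) := by
    rcases hx with rfl | rfl
    · refine ⟨inA g, rfl, ?_⟩
      rw [← inA_alt_a, ← mul_assoc, vert_mul_tau_pow, ← map_mul, vert_inA]
    · refine ⟨inA g * tau m, by simp, ?_⟩
      rw [← vert_mul_tau, mul_assoc, mul_assoc, ← mul_assoc (tau m), ← inA_alt_b, ← mul_assoc,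
        vert_mul_tau_pow, ← map_mul, vert_inA]
  obtain ⟨h, h1, h2⟩ := key
  rcases hgx with ⟨rfl, rfl⟩ | ⟨rfl, rfl⟩
  · exact ⟨h, k, h1, by rw [h2, zpow_natCast]⟩
  · exact ⟨h * uu m ^ k, -k, h2, by simp [h1]⟩

theorem exists_of_adj_vert {h : Ext m} {q : V m} (hq : (Y m).Adj (vert h) q) :
    ∃ t : ℤ, q = vert (h * uu m ^ t) ∨ q = vert (h * tau m * uu m ^ t) := by
  obtain ⟨h', t, e, rfl⟩ := exists_of_adj hq
  obtain ⟨i, rfl | rfl⟩ := exists_of_vert_eq e.symm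
  · refine ⟨t, Or.inl ?_⟩
    rw [mul_assoc, zz_zpow_comm, ← mul_assoc, vert_mul_zz_zpow]
  · refine ⟨t, Or.inr ?_⟩
    rw [mul_assoc, mul_assoc, zz_zpow_comm, ← mul_assoc, ← mul_assoc, vert_mul_zz_zpow]

theorem lenV_le_of_adj {p q : V m} (hpq : (Y m).Adj p q) : lenV p ≤ lenV q + 1 := by
  obtain ⟨h, t, rfl, rfl⟩ := exists_of_adj hpq
  rw [lenV_vert, lenV_vert, word_mul_uu_zpow]
  have h1 := length_le_len (word h).1 (word h).2
  have h2 := length_le_len ((word h).1 + (t : ZMod m)) (word h).2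
  rw [Prod.mk.eta] at h1
  omega

theorem brkV_le_of_adj {p q : V m} (hpq : (Y m).Adj p q) : brkV p ≤ brkV q + 1 := by
  obtain ⟨h, t, rfl, rfl⟩ := exists_of_adj hpq
  rw [brkV_vert, brkV_vert, word_mul_uu_zpow]
  have h1 := breaks_le_brk (word h).1 (word h).2
  have h2 := breaks_le_brk ((word h).1 + (t : ZMod m)) (word h).2
  rw [Prod.mk.eta] at h1
  omega

theorem vert_mul_uu_zpow_congr (h : Ext m) {i j : ℤ} (e : (i : ZMod m) = j) :
    vert (h * uu m ^ i) = vert (h * uu m ^ j) := by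
  obtain ⟨k, hk⟩ := (ZMod.intCast_eq_intCast_iff_dvd_sub _ _ _).1 e
  have : uu m ^ j = uu m ^ i * zz m ^ k := by
    rw [zz, ← zpow_natCast, ← zpow_mul, ← zpow_add, ← hk]; congr 1; ring
  rw [this, ← mul_assoc, vert_mul_zz_zpow]

/-- A vertex other than the base vertex has a single neighbour closer to the base vertex, given
by the removal of the last turn. -/
theorem eq_of_adj_of_lenV_lt {h : Ext m} {e : ℤ} (he : (word h).1 = e) (he0 : (e : ZMod m) ≠ 0)
    {q : V m} (hq : (Y m).Adj (vert h) q) (hlt : lenV q < lenV (vert h)) :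
    q = vert (h * uu m ^ (-e)) := by
  obtain ⟨t, rfl | rfl⟩ := exists_of_adj_vert hq
  · apply vert_mul_uu_zpow_congr
    by_contra hne
    rw [lenV_vert, lenV_vert, word_mul_uu_zpow, he] at hlt
    have h0 : (e : ZMod m) + t ≠ 0 := fun h0 => hne (by
      push_cast; exact eq_neg_of_add_eq_zero_right h0)
    rw [← Prod.mk.eta (p := word h), he, len, len, turns_of_ne he0, turns_of_ne h0] at hlt
    simp at hlt
  · exfalso
    rw [lenV_vert, lenV_vert, word_mul_uu_zpow, word_mul_tau, ← Prod.mk.eta (p := word h), he,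
      flip_of_ne he0] at hlt
    have h1 := length_le_len ((e : ZMod m) ) (word h).2
    have h2 := length_le_len ((0 : ZMod m) + (t : ZMod m)) (⟨e, he0⟩ :: (word h).2)
    simp only [List.length_cons] at h2
    dsimp only at hlt
    omega

theorem word_mul_pow {h : Ext m} {L : Turns m} (hL : word h = (0, L)) (e : ℤ)
    (he : (e : ZMod m) ≠ 0) (n : ℕ) :
    word (h * (uu m ^ e * tau m) ^ n) = (0, List.replicate n ⟨e, he⟩ ++ L) := by
  induction n with
  | zero => simpa using hL
  | succ n ih =>
    rw [pow_succ, ← mul_assoc, ← mul_assoc, word_mul_tau, word_mul_uu_zpow, ih, zero_add,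
      flip_of_ne he]
    rfl

theorem mul_a_neg_zpow (n : ℕ) :
    (uu m * tau m) ^ (-n : ℤ) = tau m * (uu m ^ (-1 : ℤ) * tau m) ^ n * tau m := by
  have := conj_pow (i := n) (a := tau m) (b := uu m ^ (-1 : ℤ) * tau m)
  rw [tau_inv] at this
  rw [← this, zpow_neg, zpow_natCast, ← inv_pow]
  simp [mul_assoc]

/-- The vertices `s ^ j ⟨Δ⟩` in terms of the extension. -/
theorem exists_gen_zpow (s : Gen) : ∃ η : Ext m, word η = (0, []) ∧
    ∀ j : ℤ, ((gen m s ^ j : Artin m) : V m) = vert (η * (uu m * tau m) ^ j) := by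
  cases s
  · refine ⟨1, word_one, fun j => ?_⟩
    rw [one_mul, ← inA_a, ← map_zpow, vert_inA]
  · refine ⟨tau m, word_tau, fun j => ?_⟩
    have := conj_zpow (i := j) (a := tau m) (b := uu m * tau m)
    rw [tau_inv] at this
    rw [← vert_mul_tau, ← this, ← vert_inA, map_zpow, inA_b]
    simp [mul_assoc]

/-- The vertices `s ^ i ⟨Δ⟩` on the same side of the base vertex as `s ^ j ⟨Δ⟩`: all turns of this
ray are equal to `e`, which is `1` or `-1`. -/
theorem exists_ray (hm : 3 ≤ m) (s : Gen) (j : ℤ) : ∃ (θ : Ext m) (e δ : ℤ), word θ = (0, []) ∧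
    (e : ZMod m) ≠ 0 ∧ (δ * j.natAbs = j ∧ |δ| = 1) ∧ ∀ n : ℕ,
    ((gen m s ^ (δ * n) : Artin m) : V m) = vert (θ * (uu m ^ e * tau m) ^ n) := by
  obtain ⟨η, h1, h2⟩ := exists_gen_zpow (m := m) s
  obtain ⟨n, hn⟩ := j.eq_nat_or_neg
  rcases hn with rfl | rfl
  · refine ⟨η, 1, 1, h1, by simpa using one_ne_zero' hm, by simp, fun n => ?_⟩
    rw [one_mul, h2, zpow_one, zpow_natCast]
  · refine ⟨η * tau m, -1, -1, by simp [h1], ?_, by simp, fun n => ?_⟩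
    · simpa using one_ne_zero' hm
    · rw [neg_one_mul, h2, mul_a_neg_zpow, ← mul_assoc, ← mul_assoc, vert_mul_tau]

theorem lenV_gen_zpow (hm : 3 ≤ m) (s : Gen) (j : ℤ) :
    lenV ((gen m s ^ j : Artin m) : V m) = j.natAbs := by
  obtain ⟨θ, e, δ, h1, h2, h3, h4⟩ := exists_ray hm s j
  have := h4 j.natAbs
  rw [h3.1] at this
  rw [this, lenV_vert, word_mul_pow h1 e h2, len, turns_zero]
  simp

/-- Neighbours of `s ^ j ⟨Δ⟩` that are closer to the base vertex are on the axis. -/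
theorem exists_eq_gen_zpow_of_adj (hm : 3 ≤ m) (s : Gen) (j : ℤ) {q : V m}
    (hq : (Y m).Adj ((gen m s ^ j : Artin m) : V m) q) (hlt : lenV q < j.natAbs) :
    ∃ j' : ℤ, q = ((gen m s ^ j' : Artin m) : V m) ∧ j'.natAbs + 1 = j.natAbs := by
  have hlt' := hlt
  rw [← lenV_gen_zpow hm s] at hlt
  obtain ⟨θ, e, δ, h1, h2, ⟨h3, hδ⟩, h4⟩ := exists_ray hm s j
  obtain ⟨n, hn⟩ : ∃ n, j.natAbs = n + 1 := ⟨j.natAbs - 1, by omega⟩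
  have h5 := h4 (n + 1)
  rw [← hn, h3, hn, pow_succ, ← mul_assoc, ← mul_assoc, vert_mul_tau] at h5
  rw [h5] at hq hlt
  refine ⟨δ * n, ?_, ?_⟩
  · rw [h4, eq_of_adj_of_lenV_lt (e := e) ?_ h2 hq hlt]
    · simp
    · rw [word_mul_uu_zpow, word_mul_pow h1 e h2]; simp
  · have : δ.natAbs = 1 := by rw [← Int.natAbs_abs, hδ]; rfl
    rw [Int.natAbs_mul, this, hn]; simp

/-! ### Maximal simplices and the tree -/

theorem finite_neighbors (hm : 3 ≤ m) (p : V m) : {q | q = p ∨ (Y m).Adj p q}.Finite := by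
  have : NeZero m := ⟨by omega⟩
  obtain ⟨g, rfl⟩ := exists_vert_eq p
  have hf : ({vert (inA g)} ∪
      ((fun t : ZMod m => vert (inA g * uu m ^ (t.val : ℤ))) '' Set.univ ∪
      (fun t : ZMod m => vert (inA g * tau m * uu m ^ (t.val : ℤ))) '' Set.univ)).Finite :=
    (Set.finite_singleton _).union ((Set.finite_univ.image _).union (Set.finite_univ.image _))
  refine hf.subset ?_
  rintro q (rfl | hq)
  · exact Or.inl rfl
  · obtain ⟨t, rfl | rfl⟩ := exists_of_adj_vert hq
    · exact Or.inr (Or.inl ⟨t, trivial, vert_mul_uu_zpow_congr _ (by simp)⟩)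
    · exact Or.inr (Or.inr ⟨t, trivial, vert_mul_uu_zpow_congr _ (by simp)⟩)

theorem exists_maximal_simplex (hm : 3 ≤ m) {p q : V m} (h : p = q ∨ (Y m).Adj p q) :
    ∃ σ : V' m, p ∈ σ.1 ∧ q ∈ σ.1 := by
  have hs : IsSimplex m {p, q} := by
    refine ⟨by simp, by simp, ?_⟩
    rcases h with rfl | h
    · simp
    · exact SimpleGraph.isClique_pair.2 fun _ => h
  have hfin : {σ : Set (V m) | IsSimplex m σ ∧ {p, q} ⊆ σ}.Finite := by
    refine (finite_neighbors hm p).finite_subsets.subset ?_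
    rintro σ ⟨hσ, hle⟩ r hr
    by_cases e : r = p
    · exact Or.inl e
    · exact Or.inr (hσ.2.2 (hle (by simp)) hr (Ne.symm e))
  obtain ⟨σ, hle, hσ⟩ := hfin.exists_le_maximal (a := {p, q}) ⟨hs, subset_rfl⟩
  refine ⟨⟨σ, hσ.1.1, fun τ hτ hστ => hσ.2 ⟨hτ, hle.trans hστ⟩ hστ⟩, hle (by simp), hle (by simp)⟩

theorem eq_or_adj_of_mem {σ : V' m} {p q : V m} (hp : p ∈ σ.1) (hq : q ∈ σ.1) :
    p = q ∨ (Y m).Adj p q := by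
  by_cases e : p = q
  · exact Or.inl e
  · exact Or.inr (σ.2.1.2.2 hp hq e)

theorem exists_walk_of_adj (hm : 3 ≤ m) {p q : V m} (h : p = q ∨ (Y m).Adj p q) :
    ∃ w : (T m).Walk (.inl p) (.inl q), w.length = 2 := by
  obtain ⟨σ, hp, hq⟩ := exists_maximal_simplex hm h
  have h1 : (T m).Adj (.inl p) (.inr σ) := hp
  have h2 : (T m).Adj (.inr σ) (.inl q) := hq
  exact ⟨.cons h1 (.cons h2 .nil), rfl⟩

theorem eq_or_adj_mul_gen (hm : 3 ≤ m) (g : Artin m) (s : Gen) :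
    (g : V m) = ((g * gen m s : Artin m) : V m) ∨
      (Y m).Adj (g : V m) ((g * gen m s : Artin m) : V m) := by
  by_cases e : (g : V m) = ((g * gen m s : Artin m) : V m)
  · exact Or.inl e
  · refine Or.inr ⟨e, g, gen m s, ⟨1, by omega, by omega, ?_⟩, Or.inl ⟨rfl, rfl⟩⟩
    cases s <;> simp [alt]

theorem exists_walk_gen_zpow (hm : 3 ≤ m) (s : Gen) (k : ℤ) (n : ℕ) :
    ∃ w : (T m).Walk (.inl ((gen m s ^ k : Artin m) : V m))
      (.inl ((gen m s ^ (k + n) : Artin m) : V m)), w.length = 2 * n := by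
  induction n with
  | zero => exact ⟨SimpleGraph.Walk.nil.copy rfl (by simp), by simp⟩
  | succ n ih =>
    obtain ⟨w, hw⟩ := ih
    obtain ⟨w', hw'⟩ := exists_walk_of_adj hm (eq_or_adj_mul_gen hm (gen m s ^ (k + n)) s)
    refine ⟨(w.append w').copy rfl ?_, ?_⟩
    · rw [← zpow_add_one, Nat.cast_succ, add_assoc]
    · rw [SimpleGraph.Walk.length_copy, SimpleGraph.Walk.length_append]; omega

theorem dist_gen_zpow_le (hm : 3 ≤ m) (s : Gen) (k l : ℤ) :
    (T m).dist (.inl ((gen m s ^ k : Artin m) : V m)) (.inl ((gen m s ^ l : Artin m) : V m)) ≤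
      2 * (k - l).natAbs := by
  rcases le_total k l with h | h
  · obtain ⟨n, rfl⟩ := Int.le.dest h
    obtain ⟨w, hw⟩ := exists_walk_gen_zpow hm s k n
    have := SimpleGraph.dist_le w
    omega
  · obtain ⟨n, rfl⟩ := Int.le.dest h
    obtain ⟨w, hw⟩ := exists_walk_gen_zpow hm s l n
    have := SimpleGraph.dist_le w
    rw [SimpleGraph.dist_comm]
    omega

theorem le_of_walk {f : V m → ℕ} (hf : ∀ p q, (Y m).Adj p q → f p ≤ f q + 1) {q : V m}
    {v v' : VertT m} (w : (T m).Walk v v') (hv' : v' = .inl q) :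
    (∀ p, v = .inl p → 2 * f p ≤ 2 * f q + w.length) ∧
      ∀ σ : V' m, v = .inr σ → ∀ p ∈ σ.1, 2 * f p ≤ 2 * f q + w.length + 1 := by
  induction w with
  | nil => subst hv'; simp
  | @cons v x v' h w ih =>
    obtain ⟨ih1, ih2⟩ := ih hv'
    rw [SimpleGraph.Walk.length_cons]
    rcases v with p | σ <;> rcases x with p' | σ'
    · exact h.elim
    · refine ⟨?_, by simp⟩
      rintro _ ⟨⟩
      have := ih2 σ' rfl p h
      omega
    · refine ⟨by simp, ?_⟩
      rintro _ ⟨⟩ p hp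
      have := ih1 p' rfl
      rcases eq_or_adj_of_mem hp h with rfl | hadj
      · omega
      · have := hf _ _ hadj
        omega
    · exact h.elim

/-- A path of minimal length between two vertices of the axis of a generator stays on
the axis. -/
theorem exists_eq_gen_zpow_of_mem_support (hm : 3 ≤ m) (s : Gen) (l : ℤ) (n : ℕ) :
    ∀ (k : ℤ), (k - l).natAbs = n → ∀ {v v' : VertT m} (w : (T m).Walk v v'),
      v = .inl ((gen m s ^ k : Artin m) : V m) → v' = .inl ((gen m s ^ l : Artin m) : V m) →
      w.length ≤ 2 * n → ∀ p, .inl p ∈ w.support →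
      ∃ j : ℤ, p = ((gen m s ^ j : Artin m) : V m) := by
  induction n with
  | zero =>
    intro k hk v v' w hv hv' hw p hp
    cases w with
    | nil =>
      rw [SimpleGraph.Walk.support_nil, List.mem_singleton, hv] at hp
      exact ⟨k, Sum.inl.inj hp⟩
    | cons h w => simp at hw
  | succ n ih =>
    intro k hk v v' w hv hv' hw p hp
    rcases w with _ | ⟨h1, w⟩
    · rw [SimpleGraph.Walk.support_nil, List.mem_singleton, hv] at hp
      exact ⟨k, Sum.inl.inj hp⟩
    subst hv
    rename_i x
    rcases x with x | σ
    · exact h1.elim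
    rcases w with _ | ⟨h2, w⟩
    · cases hv'
    rename_i x
    rcases x with q | x
    swap
    · exact h2.elim
    simp only [SimpleGraph.Walk.length_cons] at hw
    -- The distance to the end of the path, as a function on the vertices of `Y`.
    let f : V m → ℕ := fun p => lenV ((gen m s ^ (-l) : Artin m) • p)
    have hf : ∀ j : ℤ, f ((gen m s ^ j : Artin m) : V m) = (j - l).natAbs := by
      intro j
      change lenV (((gen m s ^ (-l) * gen m s ^ j : Artin m)) : V m) = _
      rw [← zpow_add, lenV_gen_zpow hm, neg_add_eq_sub]
    have hlip : ∀ p q, (Y m).Adj p q → f p ≤ f q + 1 := fun p q h =>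
      lenV_le_of_adj (Y_adj_smul _ h)
    have hq := (le_of_walk hlip w hv').1 q rfl
    rw [hf] at hq
    have hfq : f q ≤ n := by simp at hq; omega
    have hne : ((gen m s ^ k : Artin m) : V m) ≠ q := by
      rintro rfl
      rw [hf] at hfq; omega
    have hadj := Y_adj_smul (gen m s ^ (-l)) ((eq_or_adj_of_mem (σ := σ) h1 h2).resolve_left hne)
    have e : (gen m s ^ (-l)) • ((gen m s ^ k : Artin m) : V m) =
        ((gen m s ^ (k - l) : Artin m) : V m) := by
      change (((gen m s ^ (-l) * gen m s ^ k : Artin m)) : V m) = _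
      rw [← zpow_add, neg_add_eq_sub]
    rw [e] at hadj
    obtain ⟨j, hj, hj'⟩ := exists_eq_gen_zpow_of_adj hm s (k - l) hadj
      (show f q < _ by omega)
    have hq' : q = ((gen m s ^ (l + j) : Artin m) : V m) := by
      rw [zpow_neg, inv_smul_eq_iff] at hj
      rw [hj, zpow_add]; rfl
    simp only [SimpleGraph.Walk.support_cons, List.mem_cons, reduceCtorEq, false_or] at hp
    rcases hp with hp | hp
    · exact ⟨k, Sum.inl.inj hp⟩
    · exact ih (l + j) (by rw [add_sub_cancel_left]; omega) w (by rw [hq']) hv' (by omega) p hp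

theorem exists_eq_gen_zpow_of_mem_axis (hm : 3 ≤ m) {s : Gen} {p : V m}
    (hp : .inl p ∈ axis m s) : ∃ j : ℤ, p = ((gen m s ^ j : Artin m) : V m) := by
  obtain ⟨k, l, w, hw, hp⟩ := hp
  exact exists_eq_gen_zpow_of_mem_support hm s l _ k rfl w rfl rfl
    (hw.trans_le (dist_gen_zpow_le hm s k l)) p hp

theorem exists_mem_support {v v' : VertT m} (w : (T m).Walk v v') {σ : V' m}
    (hσ : .inr σ ∈ w.support) : v = .inr σ ∨ ∃ p ∈ σ.1, .inl p ∈ w.support := by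
  induction w with
  | nil => exact Or.inl (by simpa [eq_comm] using hσ)
  | @cons v x v' h w ih =>
    rw [SimpleGraph.Walk.support_cons, List.mem_cons] at hσ
    rcases hσ with hσ | hσ
    · exact Or.inl hσ.symm
    · right
      rcases ih hσ with rfl | ⟨p, hp, hp'⟩
      · rcases v with p | _
        · exact ⟨p, h, by simp⟩
        · exact h.elim
      · exact ⟨p, hp, by simp [hp']⟩

theorem exists_mem_axis_of_mem_axis {s : Gen} {σ : V' m}
    (hσ : .inr σ ∈ axis m s) : ∃ p ∈ σ.1, .inl p ∈ axis m s := by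
  obtain ⟨k, l, w, hw, hσ⟩ := hσ
  obtain h | ⟨p, hp, hp'⟩ := exists_mem_support w hσ
  · cases h
  · exact ⟨p, hp, k, l, w, hw, hp'⟩

theorem gen_zpow_mem_axis (s : Gen) (j : ℤ) :
    .inl ((gen m s ^ j : Artin m) : V m) ∈ axis m s :=
  ⟨j, j, .nil, by simp, by simp⟩

end DihedralArtin

/-! ### Elliptic and loxodromic elements of a group acting on a connected graph -/

namespace SimpleGraph
variable {A X : Type*} [Group A] [MulAction A X] {G : SimpleGraph X}

theorem dist_smul_le (hG : ∀ (h : A) v w, G.Adj (h • v) (h • w) ↔ G.Adj v w) (hc : G.Connected)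
    (h : A) (v w : X) : G.dist (h • v) (h • w) ≤ G.dist v w := by
  obtain ⟨p, hp⟩ := hc.exists_walk_length_eq_dist v w
  let f : G →g G := ⟨fun v => h • v, fun {v w} e => (hG h v w).2 e⟩
  rw [← hp, ← SimpleGraph.Walk.length_map f p]
  exact SimpleGraph.dist_le _

theorem dist_smul (hG : ∀ (h : A) v w, G.Adj (h • v) (h • w) ↔ G.Adj v w) (hc : G.Connected)
    (h : A) (v w : X) : G.dist (h • v) (h • w) = G.dist v w := by
  refine (dist_smul_le hG hc h v w).antisymm ?_
  have := dist_smul_le hG hc h⁻¹ (h • v) (h • w)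
  rwa [inv_smul_smul, inv_smul_smul] at this

theorem edist_eq_dist (hc : G.Connected) (v w : X) : G.edist v w = (G.dist v w : ℕ∞) :=
  ((hc v w).coe_dist_eq_edist).symm

theorem actsElliptically_of_dist_le
    (hG : ∀ (h : A) v w, G.Adj (h • v) (h • w) ↔ G.Adj v w) (hc : G.Connected)
    {g : A} {x : X} {D : ℕ} (hD : ∀ i : ℤ, G.dist (g ^ i • x) x ≤ D) :
    ActsElliptically G g := by
  intro y
  refine ⟨2 * G.dist x y + 2 * D, fun i j => ?_⟩
  rw [edist_eq_dist hc]
  norm_cast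
  have h1 := hc.dist_triangle (u := g ^ i • y) (v := g ^ i • x) (w := g ^ j • y)
  have h2 := hc.dist_triangle (u := g ^ i • x) (v := x) (w := g ^ j • y)
  have h3 := hc.dist_triangle (u := x) (v := g ^ j • x) (w := g ^ j • y)
  rw [dist_smul hG hc, SimpleGraph.dist_comm (u := y) (v := x)] at h1
  rw [dist_smul hG hc, SimpleGraph.dist_comm (u := x) (v := g ^ j • x)] at h3
  have h4 := hD i
  have h5 := hD j
  omega

theorem actsElliptically_of_zpow
    (hG : ∀ (h : A) v w, G.Adj (h • v) (h • w) ↔ G.Adj v w) (hc : G.Connected)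
    {g : A} {N : ℤ} (hN : N ≠ 0) (h : ActsElliptically G (g ^ N)) : ActsElliptically G g := by
  obtain ⟨x⟩ := hc.nonempty
  obtain ⟨D, hD⟩ := h x
  refine actsElliptically_of_dist_le hG hc (x := x)
    (D := D + ∑ r ∈ Finset.range N.natAbs, G.dist (g ^ r • x) x) fun i => ?_
  have hr0 := Int.emod_nonneg i hN
  obtain ⟨r, hr⟩ := Int.eq_ofNat_of_zero_le hr0
  have hlt := Int.emod_lt_abs i hN
  rw [Int.abs_eq_natAbs] at hlt
  have hmem : r ∈ Finset.range N.natAbs := by rw [Finset.mem_range]; omega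
  have hi : g ^ i = g ^ r * (g ^ N) ^ (i / N) := by
    rw [← zpow_mul, ← zpow_natCast, ← zpow_add]
    congr 1
    have := Int.emod_add_mul_ediv i N
    omega
  have h1 := hc.dist_triangle (u := g ^ i • x) (v := g ^ r • x) (w := x)
  rw [hi, mul_smul, dist_smul hG hc] at h1
  have h2 := hD (i / N) 0
  rw [zpow_zero, one_smul, edist_eq_dist hc] at h2
  norm_cast at h2
  have h3 := Finset.single_le_sum (f := fun r => G.dist (g ^ r • x) x)
    (fun _ _ => Nat.zero_le _) hmem
  rw [hi, mul_smul]
  omega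

theorem dist_zpow_smul (hG : ∀ (h : A) v w, G.Adj (h • v) (h • w) ↔ G.Adj v w)
    (hc : G.Connected) (g : A) (x : X) (i j : ℤ) :
    G.dist (g ^ i • x) (g ^ j • x) = G.dist x (g ^ (i - j).natAbs • x) := by
  rcases le_total j i with h | h
  · obtain ⟨n, rfl⟩ := Int.le.dest h
    rw [zpow_add, mul_smul, dist_smul hG hc, SimpleGraph.dist_comm]
    simp
  · obtain ⟨n, rfl⟩ := Int.le.dest h
    rw [zpow_add, mul_smul, dist_smul hG hc]
    simp

theorem dist_pow_smul_le (hG : ∀ (h : A) v w, G.Adj (h • v) (h • w) ↔ G.Adj v w)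
    (hc : G.Connected) (g : A) (x : X) (n : ℕ) :
    G.dist x (g ^ n • x) ≤ G.dist x (g • x) * n := by
  induction n with
  | zero => simp
  | succ n ih =>
    have h1 := hc.dist_triangle (u := x) (v := g ^ n • x) (w := g ^ (n + 1) • x)
    have h2 : G.dist (g ^ n • x) (g ^ (n + 1) • x) = G.dist x (g • x) := by
      rw [pow_succ, mul_smul, dist_smul hG hc]
    rw [mul_add, mul_one]
    omega

/-- An element is loxodromic if one of its orbits escapes linearly. -/
theorem actsLoxodromically_of_le (hG : ∀ (h : A) v w, G.Adj (h • v) (h • w) ↔ G.Adj v w)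
    (hc : G.Connected) {g : A} {x : X} {C : ℕ}
    (h : ∀ n : ℕ, n ≤ C * G.dist x (g ^ n • x) + C) : ActsLoxodromically G g := by
  intro y
  refine ⟨C + G.dist y (g • y), 2 * C * G.dist x y + C, fun i j => ?_⟩
  rw [edist_eq_dist hc, dist_zpow_smul hG hc]
  generalize (i - j).natAbs = n
  norm_cast
  constructor
  · have := dist_pow_smul_le hG hc g y n
    nlinarith
  · have h1 := hc.dist_triangle (u := x) (v := y) (w := g ^ n • x)
    have h2 := hc.dist_triangle (u := y) (v := g ^ n • y) (w := g ^ n • x)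
    rw [dist_smul hG hc, SimpleGraph.dist_comm (u := y) (v := x)] at h2
    have h3 : G.dist x (g ^ n • x) ≤ G.dist y (g ^ n • y) + 2 * G.dist x y := by omega
    calc n ≤ C * G.dist x (g ^ n • x) + C := h n
      _ ≤ C * (G.dist y (g ^ n • y) + 2 * G.dist x y) + C := by gcongr
      _ ≤ _ := by nlinarith [Nat.zero_le (G.dist y (g • y) * G.dist y (g ^ n • y))]

theorem not_actsElliptically_of_actsLoxodromically (hc : G.Connected) {g : A}
    (h : ActsLoxodromically G g) : ¬ ActsElliptically G g := by
  intro h'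
  obtain ⟨x⟩ := hc.nonempty
  obtain ⟨K, C, hK⟩ := h x
  obtain ⟨D, hD⟩ := h' x
  have h1 := (hK (K * D + C + 1 : ℕ) 0).2
  have h2 := hD (K * D + C + 1 : ℕ) 0
  rw [edist_eq_dist hc] at h1 h2
  rw [sub_zero, Int.natAbs_natCast] at h1
  norm_cast at h1 h2
  have h3 := Nat.mul_le_mul_left K h2
  omega

end SimpleGraph

namespace DihedralArtin
variable {m : ℕ}

/-! ### The cone-off -/

theorem reachable_vert (hm : 3 ≤ m) (g h : Artin m) :
    (T m).Reachable (.inl (h : V m)) (.inl ((h * g : Artin m) : V m)) := by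
  have hg : g ∈ Subgroup.closure {gen m Gen.a, gen m Gen.b} := by
    rw [closure_gen]; exact Subgroup.mem_top g
  induction hg using Subgroup.closure_induction generalizing h with
  | mem x hx =>
    obtain ⟨s, rfl⟩ : ∃ s, x = gen m s := by
      rcases hx with rfl | rfl <;> exact ⟨_, rfl⟩
    exact (exists_walk_of_adj hm (eq_or_adj_mul_gen hm h s)).choose.reachable
  | one => rw [mul_one]
  | mul x y _ _ hx hy =>
    rw [← mul_assoc]
    exact (hx h).trans (hy (h * x))
  | inv x _ hx =>
    have := hx (h * x⁻¹)
    rw [inv_mul_cancel_right] at this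
    exact this.symm

theorem gen_zpow_mem_smul_axis (h : Artin m) (s : Gen) (j : ℤ) :
    (.inl ((h * gen m s ^ j : Artin m) : V m) : VertT m) ∈ h • axis m s :=
  Set.smul_mem_smul_set (gen_zpow_mem_axis s j)

theorem HatT_connected (hm : 3 ≤ m) : (HatT m).Connected := by
  have key : ∀ v, (HatT m).Reachable (.inl (.inl ((1 : Artin m) : V m))) v := by
    have hV : ∀ p : V m, (HatT m).Reachable (.inl (.inl ((1 : Artin m) : V m)))
        (.inl (.inl p)) := by
      intro p
      obtain ⟨g, rfl⟩ := QuotientGroup.mk_surjective p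
      let f : T m →g HatT m := ⟨Sum.inl, fun h => h⟩
      have := (reachable_vert hm g 1).map f
      rw [one_mul] at this
      exact this
    rintro ((p | σ) | ⟨L, h, s, rfl⟩)
    · exact hV p
    · obtain ⟨p, hp⟩ := σ.2.1.2.1
      have : (HatT m).Adj (.inl (.inl p)) (.inl (.inr σ)) := hp
      exact (hV p).trans this.reachable
    · have : (HatT m).Adj (.inl (.inl ((h * gen m s ^ (0 : ℤ) : Artin m) : V m)))
          (.inr ⟨h • axis m s, h, s, rfl⟩) := gen_zpow_mem_smul_axis h s 0
      exact (hV _).trans this.reachable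
  have : Nonempty (VertHatT m) := ⟨.inl (.inl ((1 : Artin m) : V m))⟩
  exact ⟨fun v w => (key v).symm.trans (key w)⟩

/-- The vertices of `Y` next to a vertex of the cone-off. -/
def Near : VertHatT m → V m → Prop
  | .inl (.inl p'), p => p = p'
  | .inl (.inr σ), p => p ∈ σ.1
  | .inr L, p => .inl p ∈ L.1

theorem exists_near (v : VertHatT m) : ∃ p, Near v p := by
  obtain (p | σ) | ⟨L, h, s, rfl⟩ := v
  · exact ⟨p, rfl⟩
  · exact σ.2.1.2.1
  · exact ⟨_, gen_zpow_mem_smul_axis h s 0⟩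

theorem brkV_le_of_mem_simplex {σ : V' m} {p q : V m} (hp : p ∈ σ.1) (hq : q ∈ σ.1) :
    brkV p ≤ brkV q + 1 := by
  rcases eq_or_adj_of_mem hp hq with rfl | h
  · omega
  · exact brkV_le_of_adj h

theorem brkV_gen_zpow (hm : 3 ≤ m) (h : Artin m) (s : Gen) (j : ℤ) :
    brkV ((h : Artin m) : V m) ≤ brkV ((h * gen m s ^ j : Artin m) : V m) + 3 ∧
      brkV ((h * gen m s ^ j : Artin m) : V m) ≤ brkV ((h : Artin m) : V m) + 3 := by
  rw [← vert_inA, ← vert_inA, brkV_vert, brkV_vert, map_mul, map_zpow]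
  cases s
  · rw [inA_a]; exact brk_mul_a_zpow hm _ _
  · rw [inA_b]; exact brk_mul_b_zpow hm _ _

theorem brkV_le_of_mem_axes (hm : 3 ≤ m) {L : Axes m} {p q : V m} (hp : .inl p ∈ L.1)
    (hq : .inl q ∈ L.1) : brkV p ≤ brkV q + 6 := by
  obtain ⟨L, h, s, rfl⟩ := L
  have key : ∀ p, (.inl p : VertT m) ∈ h • axis m s →
      ∃ j : ℤ, p = ((h * gen m s ^ j : Artin m) : V m) := by
    intro p hp
    rw [Set.mem_smul_set_iff_inv_smul_mem] at hp
    obtain ⟨j, hj⟩ := exists_eq_gen_zpow_of_mem_axis (p := h⁻¹ • p) hm hp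
    rw [inv_smul_eq_iff] at hj
    exact ⟨j, hj⟩
  obtain ⟨i, rfl⟩ := key p hp
  obtain ⟨j, rfl⟩ := key q hq
  have h1 := brkV_gen_zpow hm h s i
  have h2 := brkV_gen_zpow hm h s j
  omega

theorem exists_mem_of_mem_axes {L : Axes m} {σ : V' m} (hσ : .inr σ ∈ L.1) :
    ∃ p ∈ σ.1, .inl p ∈ L.1 := by
  obtain ⟨L, h, s, rfl⟩ := L
  obtain ⟨v, hv, hvσ⟩ := hσ
  obtain v | σ' := v
  · cases hvσ
  · obtain ⟨p, hp, hp'⟩ := exists_mem_axis_of_mem_axis hv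
    obtain rfl : h • σ' = σ := Sum.inr.inj hvσ
    exact ⟨h • p, Set.smul_mem_smul_set hp, Set.smul_mem_smul_set (a := h) hp'⟩

/-- The number of breaks is coarsely Lipschitz on the cone-off. -/
theorem brkV_le_of_near (hm : 3 ≤ m) {v w : VertHatT m} (h : (HatT m).Adj v w) {p q : V m}
    (hp : Near v p) (hq : Near w q) : brkV p ≤ brkV q + 7 := by
  have key : ∀ {σ : V' m} {L : Axes m}, .inr σ ∈ L.1 → ∀ {p q}, p ∈ σ.1 → .inl q ∈ L.1 →
      brkV p ≤ brkV q + 7 ∧ brkV q ≤ brkV p + 7 := by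
    intro σ L hσ p q hp hq
    obtain ⟨r, hr, hr'⟩ := exists_mem_of_mem_axes hσ
    have h1 := brkV_le_of_mem_simplex hp hr
    have h2 := brkV_le_of_mem_simplex hr hp
    have h3 := brkV_le_of_mem_axes hm hr' hq
    have h4 := brkV_le_of_mem_axes hm hq hr'
    omega
  obtain (p' | σ) | L := v <;> obtain (q' | τ) | M := w
  · exact h.elim
  · cases hp
    have := brkV_le_of_mem_simplex h hq
    omega
  · cases hp
    have := brkV_le_of_mem_axes hm h hq
    omega
  · cases hq
    have := brkV_le_of_mem_simplex hp h
    omega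
  · exact h.elim
  · exact (key h hp hq).1
  · cases hq
    have := brkV_le_of_mem_axes hm hp h
    omega
  · exact (key h hq hp).2
  · exact h.elim

theorem brkV_le_dist (hm : 3 ≤ m) (p q : V m) :
    brkV q ≤ brkV p + 7 * (HatT m).dist (.inl (.inl p)) (.inl (.inl q)) := by
  obtain ⟨w, hw⟩ := (HatT_connected hm).exists_walk_length_eq_dist (.inl (.inl p)) (.inl (.inl q))
  rw [← hw]
  have key : ∀ {v v' : VertHatT m} (w : (HatT m).Walk v v') (p : V m), v' = .inl (.inl q) →
      Near v p → brkV q ≤ brkV p + 7 * w.length := by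
    intro v v' w
    induction w with
    | nil =>
      rintro p rfl hp
      cases hp
      exact le_self_add
    | cons h w ih =>
      intro p hv' hp
      obtain ⟨r, hr⟩ := exists_near _
      have h1 := ih r hv' hr
      have h2 := brkV_le_of_near hm h.symm hr hp
      rw [SimpleGraph.Walk.length_cons]
      omega
  exact key w p rfl rfl


/-! ### Cyclically reduced words -/

/-- The product `u ^ t₁ τ ⋯ u ^ tₙ τ`. -/
def prodW (L : List ℤ) : Ext m := (L.map fun n => uu m ^ n * tau m).prod

@[simp] theorem prodW_nil : prodW (m := m) [] = 1 := rfl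
@[simp] theorem prodW_cons (n : ℤ) (L : List ℤ) :
    prodW (m := m) (n :: L) = uu m ^ n * tau m * prodW L := by simp [prodW]
@[simp] theorem prodW_append (L L' : List ℤ) :
    prodW (m := m) (L ++ L') = prodW L * prodW L' := by simp [prodW]

theorem exists_prodW (h : Ext m) : ∃ (L : List ℤ) (n : ℤ), h = prodW L * uu m ^ n := by
  have hh : h ∈ Subgroup.closure {uu m, tau m} := by
    rw [closure_uu_tau]; exact Subgroup.mem_top h
  induction hh using Subgroup.closure_induction_right with
  | one => exact ⟨[], 0, by simp⟩
  | mul_right x _ y hy ih =>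
    obtain ⟨L, n, rfl⟩ := ih
    rcases hy with rfl | rfl
    · exact ⟨L, n + 1, by rw [zpow_add_one, mul_assoc]⟩
    · exact ⟨L ++ [n], 0, by simp [mul_assoc]⟩
  | mul_inv_cancel x _ y hy ih =>
    obtain ⟨L, n, rfl⟩ := ih
    rcases hy with rfl | rfl
    · exact ⟨L, n - 1, by rw [zpow_sub_one, mul_assoc]⟩
    · exact ⟨L ++ [n], 0, by simp [mul_assoc]⟩

/-- The cyclically reduced elements: powers of `u`, the involution `τ`, and the cyclically
reduced words that involve both. -/
def IsCycRed (x : Ext m) : Prop :=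
  (∃ n : ℤ, x = uu m ^ n) ∨ x = tau m ∨
    ∃ L : List ℤ, L ≠ [] ∧ (∀ n ∈ L, (n : ZMod m) ≠ 0) ∧ x = prodW L

/-- Conjugate to a cyclically reduced element up to a power of `z`. -/
def HasCycRed (h : Ext m) : Prop :=
  ∃ (c : Ext m) (k : ℤ) (x : Ext m), IsCycRed x ∧ h = c * x * c⁻¹ * zz m ^ k

theorem IsCycRed.hasCycRed {x : Ext m} (h : IsCycRed x) : HasCycRed x :=
  ⟨1, 0, x, h, by simp⟩

theorem HasCycRed.conj {h : Ext m} (hh : HasCycRed h) (d : Ext m) (j : ℤ) :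
    HasCycRed (d * h * d⁻¹ * zz m ^ j) := by
  obtain ⟨c, k, x, hx, rfl⟩ := hh
  refine ⟨d * c, k + j, x, hx, ?_⟩
  have := zz_zpow_comm k d⁻¹
  rw [zpow_add, mul_inv_rev]
  simp only [mul_assoc]
  rw [← mul_assoc (zz m ^ k) d⁻¹, this]
  simp only [mul_assoc]

theorem uu_zpow_eq_of_cast_eq {i j : ℤ} (e : (i : ZMod m) = j) :
    ∃ k : ℤ, uu m ^ i = uu m ^ j * zz m ^ k := by
  obtain ⟨k, hk⟩ := (ZMod.intCast_eq_intCast_iff_dvd_sub _ _ _).1 e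
  refine ⟨-k, ?_⟩
  rw [zz, ← zpow_natCast, ← zpow_mul, ← zpow_add]
  congr 1
  linarith

theorem hasCycRed_prodW (n : ℕ) : ∀ L : List ℤ, L.length = n → HasCycRed (prodW (m := m) L) := by
  induction n using Nat.strong_induction_on with
  | _ n ih =>
  intro L hL
  by_cases h0 : ∀ n ∈ L, (n : ZMod m) ≠ 0
  · by_cases hn : L = []
    · subst hn
      exact IsCycRed.hasCycRed (Or.inl ⟨0, by simp⟩)
    · exact IsCycRed.hasCycRed (Or.inr (Or.inr ⟨L, hn, h0, rfl⟩))
  push Not at h0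
  obtain ⟨t, ht, ht0⟩ := h0
  obtain ⟨L1, L2, rfl⟩ := List.append_of_mem ht
  obtain ⟨j, hj⟩ := uu_zpow_eq_of_cast_eq (m := m) (i := t) (j := 0) (by simpa using ht0)
  rw [zpow_zero, one_mul] at hj
  -- The factor with a trivial power of `u` is moved to the front by a cyclic permutation.
  have e1 : prodW (m := m) (L1 ++ t :: L2) =
      prodW L1 * (tau m * prodW (L2 ++ L1)) * (prodW L1)⁻¹ * zz m ^ j := by
    rw [prodW_append, prodW_cons, hj, prodW_append]
    rw [zz_zpow_comm, mul_assoc (tau m), zz_zpow_comm]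
    simp [mul_assoc]
  rw [e1]
  refine HasCycRed.conj ?_ _ _
  have hlen : (L2 ++ L1).length + 1 = n := by rw [← hL]; simp; omega
  generalize L2 ++ L1 = L at hlen ⊢
  rcases L with _ | ⟨t, L⟩
  · exact IsCycRed.hasCycRed (Or.inr (Or.inl (by simp)))
  rcases List.eq_nil_or_concat L with rfl | ⟨M, t', rfl⟩
  · have := HasCycRed.conj (IsCycRed.hasCycRed (m := m) (Or.inl ⟨t, rfl⟩)) (tau m) 0
    simpa [mul_assoc] using this
  · have := HasCycRed.conj (ih (M.length + 1) (by simp at hlen; omega) ((t' + t) :: M) (by simp))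
      (tau m * uu m ^ (-t')) 0
    simpa [mul_assoc, zpow_add] using this

theorem hasCycRed (h : Ext m) : HasCycRed h := by
  obtain ⟨L, n, rfl⟩ := exists_prodW h
  rcases L with _ | ⟨t, L⟩
  · exact IsCycRed.hasCycRed (Or.inl ⟨n, by simp⟩)
  · have := HasCycRed.conj (hasCycRed_prodW (m := m) _ ((n + t) :: L) rfl) (uu m ^ (-n)) 0
    simpa [mul_assoc, zpow_add] using this

theorem word_mul_prodW {h : Ext m} {M : Turns m} (hM : word h = (0, M)) {L : List ℤ}
    (hL : ∀ n ∈ L, (n : ZMod m) ≠ 0) : ∃ M' : Turns m, word (h * prodW L) = (0, M') ∧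
      M'.map Subtype.val = (L.map fun n : ℤ => (n : ZMod m)).reverse ++ M.map Subtype.val := by
  induction L generalizing h M with
  | nil => exact ⟨M, by simpa using hM, by simp⟩
  | cons t L ih =>
    have ht := hL t (by simp)
    have h1 : word (h * (uu m ^ t * tau m)) = (0, ⟨t, ht⟩ :: M) := by
      rw [← mul_assoc, word_mul_tau, word_mul_uu_zpow, hM, zero_add, flip_of_ne ht]
    obtain ⟨M', h2, h3⟩ := ih h1 fun n hn => hL n (by simp [hn])
    refine ⟨M', ?_, ?_⟩
    · rw [prodW_cons, ← mul_assoc, h2]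
    · rw [h3]; simp

theorem word_prodW_pow {η : Ext m} (hη : word η = (0, [])) {L : List ℤ}
    (hL : ∀ n ∈ L, (n : ZMod m) ≠ 0) (n : ℕ) : ∃ M : Turns m,
      word (η * prodW L ^ n) = (0, M) ∧ M.map Subtype.val =
        (List.replicate n (L.map fun n : ℤ => (n : ZMod m)).reverse).flatten := by
  induction n with
  | zero => exact ⟨[], by simpa using hη, by simp⟩
  | succ n ih =>
    obtain ⟨M, h1, h2⟩ := ih
    obtain ⟨M', h3, h4⟩ := word_mul_prodW h1 hL
    exact ⟨M', by rw [pow_succ, ← mul_assoc, h3], by rw [h4, h2]; rfl⟩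

theorem le_breaks_flatten {B : List (ZMod m)} {x : ZMod m} {l : List (ZMod m)} (hB : B = x :: l)
    (h : breaks (B ++ [x]) ≠ 0) (n : ℕ) :
    n ≤ breaks (List.replicate (n + 1) B).flatten := by
  induction n with
  | zero => simp
  | succ n ih =>
    have e : (List.replicate (n + 1) B).flatten =
        x :: (l ++ (List.replicate n B).flatten) := by
      subst hB; rw [List.replicate_succ, List.flatten_cons]; rfl
    rw [List.replicate_succ, List.flatten_cons, e, breaks_append, ← e]
    omega

/-- Along the powers of a cyclically reduced word whose turns are neither all `1` nor all `-1`,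
the number of breaks grows linearly. -/
theorem le_brk_prodW_pow {η : Ext m} (hη : word η = (0, [])) {L : List ℤ} (hL0 : L ≠ [])
    (hL : ∀ n ∈ L, (n : ZMod m) ≠ 0) (h1 : ¬ ∀ n ∈ L, (n : ZMod m) = 1)
    (h2 : ¬ ∀ n ∈ L, (n : ZMod m) = -1) (n : ℕ) :
    n ≤ brk (word (η * prodW L ^ n)) + 1 := by
  obtain ⟨M, h3, h4⟩ := word_prodW_pow hη hL n
  rw [h3, brk, turns_zero, h4]
  rcases n with _ | n
  · simp
  have hB0 : (L.map fun n : ℤ => (n : ZMod m)).reverse ≠ [] := by simpa using hL0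
  obtain ⟨x, l, hB⟩ := List.exists_cons_of_ne_nil hB0
  have := le_breaks_flatten hB ?_ n
  · omega
  intro h5
  obtain ⟨h6, h7⟩ := eq_of_breaks_eq_zero x _ hB0 h5
  have h8 : ∀ n ∈ L, (n : ZMod m) = x := fun n hn => h7 _ (by simpa using ⟨n, hn, rfl⟩)
  rcases h6 with rfl | rfl
  · exact h1 h8
  · exact h2 h8

theorem prodW_eq_pow {e : ℤ} (L : List ℤ) (hL : ∀ n ∈ L, (n : ZMod m) = e) :
    ∃ k : ℤ, prodW (m := m) L = (uu m ^ e * tau m) ^ L.length * zz m ^ k := by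
  induction L with
  | nil => exact ⟨0, by simp⟩
  | cons t L ih =>
    obtain ⟨k, hk⟩ := ih fun n hn => hL n (by simp [hn])
    obtain ⟨j, hj⟩ := uu_zpow_eq_of_cast_eq (hL t (by simp))
    refine ⟨j + k, ?_⟩
    rw [prodW_cons, hk, hj, List.length_cons, pow_succ', zpow_add, mul_assoc (uu m ^ e),
      zz_zpow_comm]
    simp only [mul_assoc]
    rw [← mul_assoc (zz m ^ j), zz_zpow_comm]
    simp only [mul_assoc]

/-! ### Torsion modulo the center, and central elements -/

theorem pow_mem_of_conj {c x h : Ext m} {k : ℤ} (hh : h = c * x * c⁻¹ * zz m ^ k)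
    (hx : (∃ n : ℤ, x = uu m ^ n) ∨ x = tau m) : ∃ j : ℤ, h ^ (2 * m) = zz m ^ j := by
  have hx' : ∃ i : ℤ, x ^ (2 * m) = zz m ^ i := by
    rcases hx with ⟨n, rfl⟩ | rfl
    · refine ⟨n * 2, ?_⟩
      rw [zz, ← zpow_natCast, ← zpow_natCast, ← zpow_mul, ← zpow_mul]
      congr 1; push_cast; ring
    · exact ⟨0, by rw [pow_mul, pow_two, tau_mul_tau]; simp⟩
  obtain ⟨i, hi⟩ := hx'
  refine ⟨i + k * (2 * m), ?_⟩
  have hc : Commute (c * x * c⁻¹) (zz m ^ k) := (zz_zpow_comm k _).symm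
  rw [hh, hc.mul_pow, conj_pow, hi, ← zz_zpow_comm, mul_inv_cancel_right, zpow_add, zpow_mul]
  congr 1

theorem mem_center_of_inA_eq {g : Artin m} {j : ℤ} (h : inA g = zz m ^ j) :
    g ∈ Subgroup.center (Artin m) := by
  rw [Subgroup.mem_center_iff]
  intro g'
  apply SemidirectProduct.inl_injective (φ := involutionHom (swap m) (swap_mul_swap m))
  rw [map_mul, map_mul]
  change inA g' * inA g = inA g * inA g'
  rw [h, zz_zpow_comm]

theorem conj_inA (c : Ext m) (g : Artin m) : ∃ g' : Artin m, c * inA g * c⁻¹ = inA g' := by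
  obtain ⟨h, rfl | rfl⟩ := exists_inA c
  · exact ⟨h * g * h⁻¹, by simp⟩
  · refine ⟨h * swap m g * h⁻¹, ?_⟩
    rw [map_mul, map_mul, ← tau_conj]
    simp [mul_assoc]

/-- A central element has no cyclically reduced word that involves both `u` and `τ`, since such a
word does not commute with `u ^ 2`. -/
theorem pow_eq_of_mem_center (hm : 3 ≤ m) {W : Artin m} (hW : W ∈ Subgroup.center (Artin m)) :
    ∃ j : ℤ, inA W ^ (2 * m) = zz m ^ j := by
  obtain ⟨c, k, x, hx, e⟩ := hasCycRed (inA W)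
  rcases hx with hx | hx | ⟨L, hL0, hL, rfl⟩
  · exact pow_mem_of_conj e (Or.inl hx)
  · exact pow_mem_of_conj e (Or.inr hx)
  exfalso
  have hu : uu m * uu m = inA (gen m Gen.a * gen m Gen.b) := by
    rw [map_mul, inA_a, inA_b]; simp [mul_assoc]
  obtain ⟨g, hg⟩ := conj_inA c (gen m Gen.a * gen m Gen.b)
  rw [← hu] at hg
  have h1 : inA W * inA g = inA g * inA W := by
    rw [← map_mul, ← map_mul, Subgroup.mem_center_iff.1 hW g]
  have h2 : prodW L * (uu m * uu m) = uu m * uu m * prodW L := by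
    have h3 : c * (prodW L * (uu m * uu m)) * c⁻¹ * zz m ^ k =
        c * (uu m * uu m * prodW L) * c⁻¹ * zz m ^ k := by
      rw [e, ← hg, mul_assoc _ (zz m ^ k), zz_zpow_comm] at h1
      simpa [mul_assoc] using h1
    exact mul_left_cancel (mul_right_cancel (mul_right_cancel h3))
  have h3 : uu m * uu m = uu m ^ (2 : ℤ) := by rw [← pow_two]; rfl
  obtain ⟨M, hM, -⟩ := word_mul_prodW (word_one (m := m)) hL
  obtain ⟨t, L, rfl⟩ := List.exists_cons_of_ne_nil hL0
  have h4 : word (uu m ^ (2 : ℤ)) = (2, []) := by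
    rw [← one_mul (uu m ^ (2 : ℤ)), word_mul_uu_zpow]; simp
  obtain ⟨M₁, h5⟩ : ∃ M₁, word (uu m ^ (2 : ℤ) * (uu m ^ t * tau m)) = (0, M₁) := by
    rw [← mul_assoc, word_mul_tau, word_mul_uu_zpow, h4]
    by_cases h0 : (2 : ZMod m) + t = 0
    · exact ⟨[], by simp [h0]⟩
    · exact ⟨_, flip_of_ne h0 _⟩
  obtain ⟨M₂, h6, -⟩ := word_mul_prodW h5 fun n hn => hL n (List.mem_cons_of_mem _ hn)
  have h7 := congrArg (fun x => (word x).1) h2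
  rw [one_mul] at hM
  simp only [h3, word_mul_uu_zpow, hM] at h7
  rw [prodW_cons, ← mul_assoc, h6] at h7
  have h8 : ((2 : ℕ) : ZMod m) = 0 := by simpa using h7
  rw [ZMod.natCast_eq_zero_iff] at h8
  exact absurd (Nat.le_of_dvd two_pos h8) (by omega)

/-! ### The action of the center and of the generators on the cone-off -/

theorem smul_eq_of_inA_eq {g : Artin m} {j : ℤ} (h : inA g = zz m ^ j) (v : VertHatT m) :
    g • v = v := by
  have hV : ∀ p : V m, g • p = p := by
    intro p
    obtain ⟨k, rfl⟩ := exists_vert_eq p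
    rw [← vert_inA_mul, h, zz_zpow_comm, vert_mul_zz_zpow]
  have hS : ∀ σ : Set (V m), g • σ = σ := by
    intro σ
    have : (fun p : V m => g • p) = id := funext hV
    rw [← Set.image_smul, this, Set.image_id]
  have hT : ∀ v : VertT m, g • v = v := by
    rintro (p | σ)
    · exact congrArg Sum.inl (hV p)
    · exact congrArg Sum.inr (Subtype.ext (hS σ.1))
  rcases v with v | L
  · exact congrArg Sum.inl (hT v)
  · refine congrArg Sum.inr (Subtype.ext ?_)
    have : (fun v : VertT m => g • v) = id := funext hT
    change g • L.1 = L.1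
    rw [← Set.image_smul, this, Set.image_id]

theorem actsElliptically_of_forall_smul_eq (hm : 3 ≤ m) {g : Artin m}
    (h : ∀ v : VertHatT m, g • v = v) : ActsElliptically (HatT m) g := by
  obtain ⟨x⟩ := (HatT_connected hm).nonempty
  refine SimpleGraph.actsElliptically_of_dist_le HatT_adj_smul (HatT_connected hm) (x := x) (D := 0)
    fun i => ?_
  have : g ^ i • x = x := by
    have hg : g ∈ MulAction.stabilizer (Artin m) x := h x
    exact zpow_mem hg i
  rw [this, SimpleGraph.dist_self]

theorem actsElliptically_of_zpow_mem_center (hm : 3 ≤ m) {g : Artin m} {N : ℤ} (hN : N ≠ 0)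
    (h : g ^ N ∈ Subgroup.center (Artin m)) : ActsElliptically (HatT m) g := by
  obtain ⟨j, hj⟩ := pow_eq_of_mem_center hm h
  refine SimpleGraph.actsElliptically_of_zpow HatT_adj_smul (HatT_connected hm)
    (N := N * (2 * m : ℕ)) (mul_ne_zero hN (by norm_cast; omega)) ?_
  refine actsElliptically_of_forall_smul_eq hm fun v => ?_
  rw [zpow_mul, zpow_natCast]
  exact smul_eq_of_inA_eq (j := j) (by rw [map_pow, hj]) v

theorem actsElliptically_conj_gen (hm : 3 ≤ m) (h : Artin m) (s : Gen) (N : ℤ) {W : Artin m}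
    (hW : W ∈ Subgroup.center (Artin m)) :
    ActsElliptically (HatT m) (h * gen m s ^ N * h⁻¹ * W) := by
  obtain ⟨j, hj⟩ := pow_eq_of_mem_center hm hW
  refine SimpleGraph.actsElliptically_of_zpow HatT_adj_smul (HatT_connected hm)
    (N := (2 * m : ℕ)) (by norm_cast; omega) ?_
  have hc : Commute (h * gen m s ^ N * h⁻¹) W := Subgroup.mem_center_iff.1 hW _
  have hWt : ∀ v : VertHatT m, W ^ (2 * m) • v = v :=
    smul_eq_of_inA_eq (j := j) (by rw [map_pow, hj])
  refine SimpleGraph.actsElliptically_of_dist_le HatT_adj_smul (HatT_connected hm)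
    (x := .inl (.inl (h : V m))) (D := 2) fun i => ?_
  have e : ((h * gen m s ^ N * h⁻¹ * W) ^ ((2 * m : ℕ) : ℤ)) ^ i • (Sum.inl (Sum.inl (h : V m)) :
      VertHatT m) = .inl (.inl ((h * gen m s ^ (N * ((2 * m : ℕ) : ℤ) * i) : Artin m) : V m)) := by
    have hWi : (W ^ (2 * m)) ^ i • (Sum.inl (Sum.inl (h : V m)) : VertHatT m) =
        .inl (.inl (h : V m)) := by
      have hg : W ^ (2 * m) ∈ MulAction.stabilizer (Artin m)
        (Sum.inl (Sum.inl (h : V m)) : VertHatT m) := hWt _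
      exact zpow_mem hg i
    rw [zpow_natCast, hc.mul_pow, (hc.pow_pow _ _).mul_zpow, mul_smul, hWi, ← zpow_natCast,
      conj_zpow, conj_zpow, ← zpow_mul, ← zpow_mul]
    refine congrArg Sum.inl (congrArg Sum.inl ?_)
    change ((h * _ * h⁻¹ * h : Artin m) : V m) = _
    rw [inv_mul_cancel_right, ← mul_assoc]
  rw [e]
  let L : VertHatT m := .inr ⟨h • axis m s, h, s, rfl⟩
  have key : ∀ k : ℤ, (HatT m).Adj
      (.inl (.inl ((h * gen m s ^ k : Artin m) : V m))) L := gen_zpow_mem_smul_axis h s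
  have h0 := key 0
  rw [zpow_zero, mul_one] at h0
  exact SimpleGraph.dist_le (.cons (key _) (.cons h0.symm .nil))

/-! ### The classification -/

theorem exists_conj_gen_of_inA_eq {g h : Artin m} {s : Gen} {N k : ℤ}
    (e : inA g = inA (h * gen m s ^ N * h⁻¹) * zz m ^ k) :
    ∃ (h : Artin m) (s : Gen) (N : ℤ) (W : Artin m),
      W ∈ Subgroup.center (Artin m) ∧ g = h * gen m s ^ N * h⁻¹ * W := by
  refine ⟨h, s, N, (h * gen m s ^ N * h⁻¹)⁻¹ * g, ?_, by rw [mul_inv_cancel_left]⟩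
  refine mem_center_of_inA_eq (j := k) ?_
  rw [map_mul, e, map_inv, inv_mul_cancel_left]

theorem conj_gen_of_eq {g : Artin m} {c : Ext m} {N k : ℤ}
    (e : inA g = c * (uu m * tau m) ^ N * c⁻¹ * zz m ^ k) :
    ∃ (h : Artin m) (s : Gen) (N : ℤ) (W : Artin m),
      W ∈ Subgroup.center (Artin m) ∧ g = h * gen m s ^ N * h⁻¹ * W := by
  obtain ⟨h, rfl | rfl⟩ := exists_inA c
  · refine exists_conj_gen_of_inA_eq (h := h) (s := Gen.a) (N := N) (k := k) ?_
    rw [e, map_mul, map_mul, map_zpow, inA_a, map_inv]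
  · refine exists_conj_gen_of_inA_eq (h := h) (s := Gen.b) (N := N) (k := k) ?_
    have := conj_zpow (i := N) (a := tau m) (b := uu m * tau m)
    rw [tau_inv] at this
    have h2 : tau m * (uu m * tau m) * tau m = tau m * uu m := by simp [mul_assoc]
    rw [e, map_mul, map_mul, map_zpow, inA_b, map_inv, ← h2, this, mul_inv_rev, tau_inv]
    simp only [mul_assoc]

theorem actsLoxodromically_of_conj (hm : 3 ≤ m) {g : Artin m} {c : Ext m} {L : List ℤ} {k : ℤ}
    (hL0 : L ≠ []) (hL : ∀ n ∈ L, (n : ZMod m) ≠ 0) (h1 : ¬ ∀ n ∈ L, (n : ZMod m) = 1)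
    (h2 : ¬ ∀ n ∈ L, (n : ZMod m) = -1) (e : inA g = c * prodW L * c⁻¹ * zz m ^ k) :
    ActsLoxodromically (HatT m) g := by
  refine SimpleGraph.actsLoxodromically_of_le HatT_adj_smul (HatT_connected hm)
    (x := .inl (.inl (vert c))) (C := 7) fun n => ?_
  have hn : g ^ n • (Sum.inl (Sum.inl (vert c)) : VertHatT m) =
      .inl (.inl (vert (c * prodW L ^ n))) := by
    refine congrArg Sum.inl (congrArg Sum.inl ?_)
    have hc : Commute (c * prodW L * c⁻¹) (zz m ^ k) := (zz_zpow_comm k _).symm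
    change g ^ n • vert c = _
    rw [← vert_inA_mul, map_pow, e, hc.mul_pow, conj_pow, ← zpow_natCast (zz m ^ k), ← zpow_mul,
      mul_assoc, zz_zpow_comm, ← mul_assoc, vert_mul_zz_zpow, inv_mul_cancel_right]
  rw [hn]
  -- Translation by an element of the Artin group moves the first point to the base vertex.
  obtain ⟨h, η, hη, rfl⟩ : ∃ (h : Artin m) (η : Ext m), word η = (0, []) ∧ c = inA h * η := by
    obtain ⟨h, rfl | rfl⟩ := exists_inA c
    · exact ⟨h, 1, word_one, (mul_one _).symm⟩
    · exact ⟨h, tau m, word_tau, rfl⟩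
  have hd := SimpleGraph.dist_smul (G := HatT m) HatT_adj_smul (HatT_connected hm) h
    (.inl (.inl (vert η))) (.inl (.inl (vert (η * prodW L ^ n))))
  rw [mul_assoc, vert_inA_mul, vert_inA_mul]
  change (HatT m).dist (.inl (.inl (h • vert η))) (.inl (.inl (h • vert (η * prodW L ^ n)))) = _
    at hd
  rw [hd]
  have h3 := brkV_le_dist hm (vert η) (vert (η * prodW L ^ n))
  have h4 := le_brk_prodW_pow hη hL0 hL h1 h2 n
  have h5 : brk ((0, []) : RedWord m) = 0 := by simp [brk, turns_zero]
  rw [brkV_vert, brkV_vert, hη, h5] at h3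
  omega

/-- Read off from the cyclically reduced form: powers of `u` and `τ` have a central power, the
words whose turns are all `1` or all `-1` are conjugate to powers of a generator, and the breaks of
all the others make them loxodromic. -/
theorem conj_gen_or_zpow_mem_center_or_actsLoxodromically (hm : 3 ≤ m) (g : Artin m) :
    (∃ (h : Artin m) (s : Gen) (N : ℤ) (W : Artin m),
      W ∈ Subgroup.center (Artin m) ∧ g = h * gen m s ^ N * h⁻¹ * W) ∨
    (∃ N : ℤ, N ≠ 0 ∧ g ^ N ∈ Subgroup.center (Artin m)) ∨ ActsLoxodromically (HatT m) g := by
  obtain ⟨c, k, x, hx, e⟩ := hasCycRed (inA g)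
  have hfin : ((∃ n : ℤ, x = uu m ^ n) ∨ x = tau m) →
      ∃ N : ℤ, N ≠ 0 ∧ g ^ N ∈ Subgroup.center (Artin m) := by
    intro hx
    obtain ⟨j, hj⟩ := pow_mem_of_conj e hx
    refine ⟨(2 * m : ℕ), by norm_cast; omega, ?_⟩
    rw [zpow_natCast]
    exact mem_center_of_inA_eq (j := j) (by rw [map_pow, hj])
  rcases hx with hx | hx | ⟨L, hL0, hL, rfl⟩
  · exact Or.inr (Or.inl (hfin (Or.inl hx)))
  · exact Or.inr (Or.inl (hfin (Or.inr hx)))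
  by_cases h1 : ∀ n ∈ L, (n : ZMod m) = 1
  · obtain ⟨j, hj⟩ := prodW_eq_pow (m := m) (e := 1) L (by simpa using h1)
    refine Or.inl (conj_gen_of_eq (c := c) (N := L.length) (k := j + k) ?_)
    rw [e, hj, zpow_one, zpow_natCast, zpow_add, mul_assoc c, mul_assoc _ (zz m ^ j),
      zz_zpow_comm]
    simp only [mul_assoc]
  by_cases h2 : ∀ n ∈ L, (n : ZMod m) = -1
  · obtain ⟨j, hj⟩ := prodW_eq_pow (m := m) (e := -1) L (by simpa using h2)
    refine Or.inl (conj_gen_of_eq (c := c * tau m) (N := -L.length) (k := j + k) ?_)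
    rw [e, hj, mul_a_neg_zpow, zpow_add, mul_assoc c, mul_assoc _ (zz m ^ j), zz_zpow_comm,
      mul_inv_rev, tau_inv]
    simp [mul_assoc]
  · exact Or.inr (Or.inr (actsLoxodromically_of_conj hm hL0 hL h1 h2 e))

end DihedralArtin

theorem mainTheorem6 (m : ℕ) (hm : 3 ≤ m) :
    (∀ g : DihedralArtin.Artin m,
      ActsElliptically (DihedralArtin.HatT m) g ↔
        ((∃ (h : DihedralArtin.Artin m) (s : DihedralArtin.Gen) (N : ℤ)
            (W : DihedralArtin.Artin m),
            W ∈ Subgroup.center (DihedralArtin.Artin m) ∧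
              g = h * DihedralArtin.gen m s ^ N * h⁻¹ * W) ∨
          (∃ N : ℤ, N ≠ 0 ∧ g ^ N ∈ Subgroup.center (DihedralArtin.Artin m)))) ∧
    (∀ g : DihedralArtin.Artin m, ¬ ActsElliptically (DihedralArtin.HatT m) g →
      ActsLoxodromically (DihedralArtin.HatT m) g) := by
  have key : ∀ g : DihedralArtin.Artin m,
      ((∃ (h : DihedralArtin.Artin m) (s : DihedralArtin.Gen) (N : ℤ)
            (W : DihedralArtin.Artin m),
            W ∈ Subgroup.center (DihedralArtin.Artin m) ∧
              g = h * DihedralArtin.gen m s ^ N * h⁻¹ * W) ∨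
          (∃ N : ℤ, N ≠ 0 ∧ g ^ N ∈ Subgroup.center (DihedralArtin.Artin m))) →
      ActsElliptically (DihedralArtin.HatT m) g := by
    rintro g (⟨h, s, N, W, hW, rfl⟩ | ⟨N, hN, hg⟩)
    · exact DihedralArtin.actsElliptically_conj_gen hm h s N hW
    · exact DihedralArtin.actsElliptically_of_zpow_mem_center hm hN hg
  refine ⟨fun g => ⟨fun hg => ?_, key g⟩, fun g hg => ?_⟩
  · rcases DihedralArtin.conj_gen_or_zpow_mem_center_or_actsLoxodromically hm g with h | h | h
    · exact Or.inl h
    · exact Or.inr h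
    · exact absurd hg (SimpleGraph.not_actsElliptically_of_actsLoxodromically
        (DihedralArtin.HatT_connected hm) h)
  · rcases DihedralArtin.conj_gen_or_zpow_mem_center_or_actsLoxodromically hm g with h | h | h
    · exact absurd (key g (Or.inl h)) hg
    · exact absurd (key g (Or.inr h)) hg
    · exact h
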